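/- Let $d\ge 1$, $A^*\in\mathbb{R}^{d\times d}$ and $x_{t+1}=A^*x_t+w_t$ for $t\ge 0$, where $x_0,w_0,w_1,\dots$ are random vectors in $\mathbb{R}^d$. Put $\mathcal F_t=\sigma(x_0,w_0,\dots,w_{t-1})$ and call $t$ an attack time if $w_t\neq 0$. For a real random variable $X$ let $\|X\|_{\psi_2}=\inf\{c>0:\mathbb E[\exp(X^2/c^2)]\le 2\}$, and for a random vector $W$ let $\|W\|_{\psi_2}=\sup_{\|u\|_2\le1}\|W^Tu\|_{\psi_2}$; a vector is called sub-Gaussian if all $W^Tu$ have finite $\psi_2$-norm. Let $p\in(0,1)$, $\sigma_w>0$, $\lambda>0$, and assume: 1. (Operator norm) $\|A^*\|_2<1$. 2. (Maximum sub-Gaussian norm) $\|x_0\|_{\psi_2}\le\sigma_w$, and for every $t\ge0$, conditionally on $\mathcal F_t$ and on $t$ being an attack time, $\|w_t\|_{\psi_2}\le\sigma_w$. 3. (Probabilistic attack) $\mathbb P(w_t=0\mid\mathcal F_t)=1-p$ for every $t\ge0$. 4. (Non-degeneracy) For every $t\ge0$ and every $x\in\mathbb R^d$, conditionally on $\mathcal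 F_t$ and on $t$ being an attack time, $\mathbb E[(x+w_t)(x+w_t)^T]\succeq\lambda^2 I_d$. 5. (Sign-restricted disturbances) At attack times $w_t=\alpha_t\circ\beta_t$ (entrywise product), where, conditionally on $\mathcal F_t$ and on $t$ being an attack time, $\alpha_t$ is sub-Gaussian and $\mathbb P(\alpha_t^i>0)=\mathbb P(\alpha_t^i<0)$ for all $i$; and for all $t$ and $i$ there is a constant $B>0$ with $0<\beta_t^i\le B$. Let $\tau=\sigma_w/\lambda$. There is a universal constant $C>0$ such that for every $\delta\in(0,1]$ and every integer $$T\ \ge\ C\cdot\frac{d\,\max\{1,\tau^{10}\}}{p(1-p)^2(1-\|A^*\|_2)^2}\cdot\max\Bigl\{1,\log\Bigl(\frac{d\,\tau}{\delta(1-p)(1-\|A^*\|_2)}\Bigr)\Bigr\},$$ with probability at least $1-\delta$ the matrix $A^*$ is the unique minimizer over $A\in\mathbb R^{d\times d}$ of the $\ell_1$-norm estimator objective $\sum_{t=0}^{T-1}\|x_{t+1}-Ax_t\|_1$. -/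

import Mathlib

open MeasureTheory ProbabilityTheory
open scoped ENNReal

noncomputable section

namespace LinSysId

/-- Vectors of `ℝ^d` with the Euclidean norm. -/
abbrev Vec (d : ℕ) : Type := EuclideanSpace ℝ (Fin d)

/-! ### Sub-Gaussian norms -/

/-- The sub-Gaussian norm of a real random variable `X`: the infimum of all `c > 0` such that
`E[exp (X² / c²)] ≤ 2`. It is `∞` if there is no such `c`. -/
def psi2Norm {Ω : Type*} [MeasurableSpace Ω] (μ : Measure Ω) (X : Ω → ℝ) : ℝ≥0∞ :=
  ⨅ (c : ℝ) (_ : 0 < c ∧ ∫⁻ ω, ENNReal.ofReal (Real.exp (X ω ^ 2 / c ^ 2)) ∂μ ≤ 2),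
    ENNReal.ofReal c

/-- The sub-Gaussian norm of a probability law on `ℝ^d`: the supremum over the Euclidean unit ball
of the sub-Gaussian norms of the one-dimensional marginals. -/
def vecPsi2Norm {d : ℕ} (ν : Measure (Vec d)) : ℝ≥0∞ :=
  ⨆ (u : Vec d) (_ : ‖u‖ ≤ 1), psi2Norm ν (fun v => inner ℝ v u)

/-- A probability law on `ℝ^d` is sub-Gaussian if all its one-dimensional marginals are. -/
def IsSubGaussianLaw {d : ℕ} (ν : Measure (Vec d)) : Prop :=
  ∀ u : Vec d, psi2Norm ν (fun v => inner ℝ v u) < ∞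

/-! ### The system and the estimator -/

/-- The action of a matrix on Euclidean vectors; its norm is the operator norm `‖A‖₂`. -/
abbrev matCLM {d : ℕ} (A : Matrix (Fin d) (Fin d) ℝ) : Vec d →L[ℝ] Vec d :=
  Matrix.toEuclideanCLM (n := Fin d) (𝕜 := ℝ) A

/-- The trajectory of `x_{t+1} = A x_t + w_t` started at `x₀`. -/
def trajectory {d : ℕ} (A : Matrix (Fin d) (Fin d) ℝ) (x₀ : Vec d) (w : ℕ → Vec d) : ℕ → Vec d
  | 0 => x₀
  | t + 1 => matCLM A (trajectory A x₀ w t) + w t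

/-- The `l₁`-norm of a vector. -/
def l1Norm {d : ℕ} (v : Vec d) : ℝ := ∑ i, |v i|

/-- The objective of the `l₁`-norm estimator at time `T`: `∑_{t<T} ‖x_{t+1} - A x_t‖₁`. -/
def l1Loss {d : ℕ} (x : ℕ → Vec d) (T : ℕ) (A : Matrix (Fin d) (Fin d) ℝ) : ℝ :=
  ∑ t ∈ Finset.range T, l1Norm (x (t + 1) - matCLM A (x t))

/-- The set of all solutions of the `l₁`-norm estimator at time `T`. -/
def l1Solutions {d : ℕ} (x : ℕ → Vec d) (T : ℕ) : Set (Matrix (Fin d) (Fin d) ℝ) :=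
  {A | ∀ A', l1Loss x T A ≤ l1Loss x T A'}

/-! ### Conditioning on the past and on an attack -/

section Conditioning

variable {d : ℕ} {Ω : Type*} [MeasurableSpace Ω]

/-- The information `(x₀, w₀, …, w_{t-1})`, which generates the sigma-algebra `F_t`. -/
def history (x₀ : Ω → Vec d) (w : ℕ → Ω → Vec d) (t : ℕ) (ω : Ω) : Vec d × (Fin t → Vec d) :=
  (x₀ ω, fun k => w k ω)

/-- The event that `t` is an attack time. -/
def attack (w : ℕ → Ω → Vec d) (t : ℕ) : Set Ω := {ω | w t ω ≠ 0}

/-- The regular conditional law of a random vector `X` given `F_t`. -/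
def lawGivenPast (μ : Measure Ω) [IsProbabilityMeasure μ] (x₀ : Ω → Vec d) (w : ℕ → Ω → Vec d)
    (t : ℕ) (X : Ω → Vec d) (ω : Ω) : Measure (Vec d) :=
  condDistrib X (history x₀ w t) μ (history x₀ w t ω)

/-- The regular conditional law of a random vector `X` given `F_t` and given that `t` is an attack
time. -/
def lawGivenPastAttack (μ : Measure Ω) [IsProbabilityMeasure μ] (x₀ : Ω → Vec d)
    (w : ℕ → Ω → Vec d) (t : ℕ) (X : Ω → Vec d) (ω : Ω) : Measure (Vec d) :=
  condDistrib X (history x₀ w t) (μ[|attack w t]) (history x₀ w t ω)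

/-! ### The assumptions -/

/-- Maximum sub-Gaussian norm: `‖x₀‖_ψ₂ ≤ σ`, and at every attack time the disturbance has
sub-Gaussian norm at most `σ` conditionally on the past. -/
def MaxSubGaussianNorm (μ : Measure Ω) [IsProbabilityMeasure μ] (x₀ : Ω → Vec d)
    (w : ℕ → Ω → Vec d) (σ : ℝ) : Prop :=
  vecPsi2Norm (μ.map x₀) ≤ ENNReal.ofReal σ ∧
  ∀ t, ∀ᵐ ω ∂(μ[|attack w t]),
    vecPsi2Norm (lawGivenPastAttack μ x₀ w t (w t) ω) ≤ ENNReal.ofReal σ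

/-- Probabilistic attack: `P(w_t = 0 | F_t) = 1 - p`. -/
def ProbabilisticAttack (μ : Measure Ω) [IsProbabilityMeasure μ] (x₀ : Ω → Vec d)
    (w : ℕ → Ω → Vec d) (p : ℝ) : Prop :=
  ∀ t, ∀ᵐ ω ∂μ, lawGivenPast μ x₀ w t (w t) ω {0} = ENNReal.ofReal (1 - p)

/-- The second moment matrix `E[(x + W)(x + W)ᵀ]` of a random vector `W` with law `ν`. -/
def shiftedSecondMoment (ν : Measure (Vec d)) (x : Vec d) : Matrix (Fin d) (Fin d) ℝ :=
  Matrix.of fun i j => ∫ v, (x i + v i) * (x j + v j) ∂ν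

/-- Non-degeneracy: at every attack time, `E[(x + w_t)(x + w_t)ᵀ | F_t] ⪰ lam² I` for all `x`. -/
def NonDegenerate (μ : Measure Ω) [IsProbabilityMeasure μ] (x₀ : Ω → Vec d)
    (w : ℕ → Ω → Vec d) (lam : ℝ) : Prop :=
  ∀ t, ∀ᵐ ω ∂(μ[|attack w t]), ∀ x : Vec d,
    (shiftedSecondMoment (lawGivenPastAttack μ x₀ w t (w t) ω) x
      - lam ^ 2 • (1 : Matrix (Fin d) (Fin d) ℝ)).PosSemidef

/-- Sign-restricted disturbances: at the attack times `w_t = α_t ∘ β_t` (entrywise product), where,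
conditionally on the past, `α_t` is sub-Gaussian and each of its entries is positive or negative
with equal probability, and the entries of `β_t` are positive and bounded. -/
def SignRestricted (μ : Measure Ω) [IsProbabilityMeasure μ] (x₀ : Ω → Vec d)
    (w : ℕ → Ω → Vec d) : Prop :=
  ∃ α β : ℕ → Ω → Vec d, (∀ t, Measurable (α t)) ∧ (∀ t, Measurable (β t)) ∧
    ∀ t,
      (∀ᵐ ω ∂(μ[|attack w t]), ∀ i, w t ω i = α t ω i * β t ω i) ∧
      (∀ᵐ ω ∂(μ[|attack w t]), IsSubGaussianLaw (lawGivenPastAttack μ x₀ w t (α t) ω)) ∧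
      (∀ i, ∀ᵐ ω ∂(μ[|attack w t]),
        lawGivenPastAttack μ x₀ w t (α t) ω {v | 0 < v i}
          = lawGivenPastAttack μ x₀ w t (α t) ω {v | v i < 0}) ∧
      (∀ i, ∃ B : ℝ, 0 < B ∧ ∀ᵐ ω ∂(μ[|attack w t]), 0 < β t ω i ∧ β t ω i ≤ B)

end Conditioning

end LinSysId

end

/-!
Write `y_t = ⟨x_t, m⟩` for a row direction `m`. Since `|w - y| - |w| ≥ -sign(w) y`, and the left
side is `|y|` for `w = 0`, the matrix `A` is the unique minimizer as soon as for every coordinate `i`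
and every `m ≠ 0` the total slope `∑_{t<T} signSlope (w_t) i (y_t)` is positive, where `signSlope` is
`|y|` at attack-free times and `-sign(w i) y` at attack times (`l1Solutions_eq_singleton`).

For a fixed unit vector `m`, let `s = 2σ`. Conditionally on the past, the signs are symmetric
and an attack has probability `p`, so the slope at time `t` has mean `(1 - p) |y_t|` and lies in
`[-|y_t|, |y_t|]`. The corresponding exponential supermartingale (`lintegral_exp_slope_le`) bounds the
total slope below by `(1 - p) ∑ |y_t| - 4 θ ∑ y_t²`, up to an error `E / θ` and with probability
`1 - exp (-E)`. Two more exponential moment bounds finish the fixed direction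
(`measure_slope_lt_le`):

* `∑ |y_t|` is at least of order `lam p T (lam / s)⁴`, since after an attack `|y_{t+1}|` is of
  order `lam` with conditional probability of order `(lam / s)⁴`, by non-degeneracy and a
  Paley–Zygmund argument (`smallBall_exp`, `lintegral_exp_truncEnergy_le`);
* `∑ y_t²` is at most of order `p T s² / (1 - ‖A‖)²`, by unrolling the recursion and using
  Cauchy–Schwarz and Jensen's inequality to reduce to sums `∑ ⟨w_t, v⟩²` in fixed directions
  (`sum_inner_trajectory_sq_le`, `lintegral_exp_energy_le`).

All conditional estimates go through a single step, `lintegral_step_le`, which disintegrates along the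
regular conditional laws. Uniformity in `m` comes from the integer grid in a cube of side `2N`
(`slope_pos_of_grid`): the total slope is Lipschitz in `m` with constant `∑ ‖x_t‖₁`, which is of order
`d² p T s / (1 - ‖A‖)` (`sum_l1Norm_trajectory_le`, `measure_coord_ge_le`). The factor `p T` is
common to this constant and to the lower bound for the slope, so that `N` depends polynomially on
`d (s / lam) / ((1 - p) (1 - ‖A‖))` alone and the logarithm in the sample size is free of `p` and `T`
(`exists_grid_size`).
-/

noncomputable section

namespace LinSysId

/-! ### Integrating against the past -/

section Past

variable {d : ℕ} {Ω : Type*} {x₀ : Ω → Vec d} {w : ℕ → Ω → Vec d}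

/-- The sigma-algebra `F_t` generated by `x₀, w₀, …, w_{t-1}`. -/
abbrev past (x₀ : Ω → Vec d) (w : ℕ → Ω → Vec d) (t : ℕ) : MeasurableSpace Ω :=
  MeasurableSpace.comap (history x₀ w t) inferInstance

lemma measurable_past_init (t : ℕ) : Measurable[past x₀ w t] x₀ :=
  measurable_fst.comp (comap_measurable (history x₀ w t))

lemma measurable_past_noise {s t : ℕ} (h : s < t) : Measurable[past x₀ w t] (w s) :=
  ((measurable_pi_apply (⟨s, h⟩ : Fin t)).comp measurable_snd).comp
    (comap_measurable (history x₀ w t))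

lemma compl_attack (t : ℕ) : (attack w t)ᶜ = {ω | w t ω = 0} := by
  ext ω; simp [attack]

lemma past_mono {s t : ℕ} (h : s ≤ t) : past x₀ w s ≤ past x₀ w t := by
  let _ : MeasurableSpace Ω := past x₀ w t
  have hm : Measurable (history x₀ w s) := (measurable_past_init t).prodMk
    (measurable_pi_lambda _ fun k => measurable_past_noise (k.2.trans_le h))
  rintro _ ⟨S, hS, rfl⟩
  exact hm hS

lemma measurable_past_trajectory (A : Matrix (Fin d) (Fin d) ℝ) {s t : ℕ} (h : s ≤ t) :
    Measurable[past x₀ w t] (fun ω => trajectory A (x₀ ω) (fun k => w k ω) s) := by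
  induction s with
  | zero => exact measurable_past_init t
  | succ s ih =>
    exact ((matCLM A).continuous.measurable.comp (ih (by omega))).add
      (measurable_past_noise (by omega))

/-- The coordinate `⟨x_t, u⟩` of the trajectory in direction `u`. -/
def proj (A : Matrix (Fin d) (Fin d) ℝ) (x₀ : Ω → Vec d) (w : ℕ → Ω → Vec d) (u : Vec d) (t : ℕ)
    (ω : Ω) : ℝ :=
  inner ℝ (trajectory A (x₀ ω) (fun k => w k ω) t) u

lemma measurable_past_proj (A : Matrix (Fin d) (Fin d) ℝ) (u : Vec d) {s t : ℕ} (h : s ≤ t) :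
    Measurable[past x₀ w t] (proj A x₀ w u s) :=
  (show Measurable fun x : Vec d => inner ℝ x u by fun_prop).comp
    (measurable_past_trajectory A h)

variable [MeasurableSpace Ω]

lemma measurable_history (hx : Measurable x₀) (hw : ∀ t, Measurable (w t)) (t : ℕ) :
    Measurable (history x₀ w t) :=
  hx.prodMk (measurable_pi_lambda _ fun k => hw k)

lemma past_le (hx : Measurable x₀) (hw : ∀ t, Measurable (w t)) (t : ℕ) :
    past x₀ w t ≤ (inferInstance : MeasurableSpace Ω) :=
  (measurable_history hx hw t).comap_le

/-- Disintegration of a joint law along the regular conditional distribution. -/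
lemma lintegral_eq_lintegral_condDistrib {β : Type*} [MeasurableSpace β] {ν : Measure Ω}
    [IsFiniteMeasure ν] {Z : Ω → β} {X : Ω → Vec d} (hZ : Measurable Z) (hX : Measurable X)
    {F : β × Vec d → ℝ≥0∞} (hF : Measurable F) :
    ∫⁻ ω, F (Z ω, X ω) ∂ν = ∫⁻ ω, ∫⁻ v, F (Z ω, v) ∂(condDistrib X Z ν (Z ω)) ∂ν := by
  rw [← lintegral_map (μ := ν) (g := fun ω => (Z ω, X ω)) hF (hZ.prodMk hX),
    ← compProd_map_condDistrib hX.aemeasurable, Measure.lintegral_compProd hF]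
  rw [lintegral_map _ hZ]
  exact hF.lintegral_kernel_prod_right'

variable {μ : Measure Ω} [IsProbabilityMeasure μ]

lemma measurableSet_attack (hw : ∀ t, Measurable (w t)) (t : ℕ) :
    MeasurableSet (attack w t) :=
  (hw t) (measurableSet_singleton 0).compl

/-- An attack at time `t` has probability `p`, independently of the past. -/
lemma setLIntegral_past (hx : Measurable x₀) (hw : ∀ t, Measurable (w t)) {p : ℝ}
    (hp1 : p < 1) (hatt : ProbabilisticAttack μ x₀ w p) (t : ℕ) {H : Ω → ℝ≥0∞}
    (hH : Measurable[past x₀ w t] H) :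
    ∫⁻ ω in attack w t, H ω ∂μ = ENNReal.ofReal p * ∫⁻ ω, H ω ∂μ ∧
    ∫⁻ ω in (attack w t)ᶜ, H ω ∂μ = ENNReal.ofReal (1 - p) * ∫⁻ ω, H ω ∂μ := by
  obtain ⟨g, hg, rfl⟩ := hH.exists_eq_measurable_comp
  have hh := measurable_history hx hw t
  have key : ∀ (S : Set (Vec d)) (c : ℝ≥0∞), MeasurableSet S →
      (∀ᵐ ω ∂μ, lawGivenPast μ x₀ w t (w t) ω S = c) →
      ∫⁻ ω in (w t) ⁻¹' S, (g ∘ history x₀ w t) ω ∂μ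
        = c * ∫⁻ ω, (g ∘ history x₀ w t) ω ∂μ := by
    intro S c hS hc
    have h1 := lintegral_eq_lintegral_condDistrib (ν := μ) hh (hw t)
      (F := fun z => g z.1 * S.indicator 1 z.2)
      ((hg.comp measurable_fst).mul ((measurable_one.indicator hS).comp measurable_snd))
    rw [← lintegral_indicator (hw t hS)]
    rw [← lintegral_const_mul _ (hg.comp hh)]
    have h2 : ∀ ω, ((w t) ⁻¹' S).indicator (fun ω => (g ∘ history x₀ w t) ω) ω
        = g (history x₀ w t ω) * S.indicator 1 (w t ω) := by
      intro ω
      by_cases h : w t ω ∈ S <;> simp [Set.indicator, h]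
    simp_rw [h2]
    rw [h1]
    refine lintegral_congr_ae ?_
    filter_upwards [hc] with ω hω
    rw [lintegral_const_mul _ (measurable_one.indicator hS), lintegral_indicator_one hS, mul_comm]
    exact congrArg (· * g (history x₀ w t ω)) hω
  have hpz : ∀ᵐ ω ∂μ, lawGivenPast μ x₀ w t (w t) ω {0}ᶜ = ENNReal.ofReal p := by
    filter_upwards [hatt t] with ω hω
    have : IsProbabilityMeasure (lawGivenPast μ x₀ w t (w t) ω) := by
      unfold lawGivenPast; infer_instance
    rw [prob_compl_eq_one_sub (measurableSet_singleton 0), hω, ← ENNReal.ofReal_one,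
      ← ENNReal.ofReal_sub _ (by linarith)]
    congr 1; ring
  refine ⟨key {0}ᶜ _ (measurableSet_singleton 0).compl hpz, ?_⟩
  rw [compl_attack]
  exact key {0} _ (measurableSet_singleton 0) (hatt t)

lemma measure_attack (hx : Measurable x₀) (hw : ∀ t, Measurable (w t)) {p : ℝ}
    (hp1 : p < 1) (hatt : ProbabilisticAttack μ x₀ w p) (t : ℕ) :
    μ (attack w t) = ENNReal.ofReal p := by
  simpa using (setLIntegral_past hx hw hp1 hatt t (H := fun _ => 1) measurable_const).1

lemma setLIntegral_eq_mul_cond {S : Set Ω} (hS : μ S ≠ 0) (f : Ω → ℝ≥0∞) :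
    ∫⁻ ω in S, f ω ∂μ = μ S * ∫⁻ ω, f ω ∂(μ[|S]) := by
  rw [ProbabilityTheory.cond, lintegral_smul_measure, smul_eq_mul, ← mul_assoc,
    ENNReal.mul_inv_cancel hS (measure_ne_top _ _), one_mul]

/-- Conditional expectations given the past and an attack can be bounded inside an integral: `y` and
`H` depend on the past only, while `X` is arbitrary. -/
lemma setLIntegral_attack_le (hx : Measurable x₀) (hw : ∀ t, Measurable (w t)) {p : ℝ}
    (hp : 0 < p) (hp1 : p < 1) (hatt : ProbabilisticAttack μ x₀ w p) (t : ℕ)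
    {X : Ω → Vec d} (hX : Measurable X) {E : Type*} [MeasurableSpace E] [StandardBorelSpace E]
    [Nonempty E] {y : Ω → E} (hy : Measurable[past x₀ w t] y) {H : Ω → ℝ≥0∞}
    (hH : Measurable[past x₀ w t] H) {φ : E × Vec d → ℝ≥0∞} (hφ : Measurable φ)
    {b : E → ℝ≥0∞} (hb : Measurable b)
    (hbound : ∀ᵐ ω ∂(μ[|attack w t]), ∀ z,
      ∫⁻ v, φ (z, v) ∂(lawGivenPastAttack μ x₀ w t X ω) ≤ b z) :
    ∫⁻ ω in attack w t, H ω * φ (y ω, X ω) ∂μ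
      ≤ ENNReal.ofReal p * ∫⁻ ω, H ω * b (y ω) ∂μ := by
  have hatt' := measure_attack hx hw hp1 hatt t
  have hne : μ (attack w t) ≠ 0 := by rw [hatt']; simpa using hp
  rw [← (setLIntegral_past hx hw hp1 hatt t (H := fun ω => H ω * b (y ω))
    (hH.mul (hb.comp hy))).1]
  rw [setLIntegral_eq_mul_cond hne, setLIntegral_eq_mul_cond hne]
  gcongr 1
  obtain ⟨g, hg, rfl⟩ := hH.exists_eq_measurable_comp
  obtain ⟨k, hk, rfl⟩ := hy.exists_eq_measurable_comp
  have h1 := lintegral_eq_lintegral_condDistrib (ν := μ[|attack w t])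
    (measurable_history hx hw t) hX (F := fun z => g z.1 * φ (k z.1, z.2))
    ((hg.comp measurable_fst).mul
      (hφ.comp ((hk.comp measurable_fst).prodMk measurable_snd)))
  simp only [Function.comp]
  simp only at h1
  rw [h1]
  refine lintegral_mono_ae ?_
  filter_upwards [hbound] with ω hω
  have hm : Measurable fun v => φ (k (history x₀ w t ω), v) :=
    hφ.comp (measurable_const.prodMk measurable_id)
  rw [lintegral_const_mul _ hm]
  gcongr
  exact hω _

/-- The one-step estimate behind all exponential supermartingales below: a factor which equals
`φ₀ (y)` when there is no attack, and at most `φ (y, X)` when there is one, contributes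
`(1 - p) φ₀ (y) + p b (y)`, where `b` bounds the conditional expectation of `φ (·, X)`. -/
lemma lintegral_step_le (hx : Measurable x₀) (hw : ∀ t, Measurable (w t)) {p : ℝ}
    (hp : 0 < p) (hp1 : p < 1) (hatt : ProbabilisticAttack μ x₀ w p) (t : ℕ)
    {X : Ω → Vec d} (hX : Measurable X) {E : Type*} [MeasurableSpace E] [StandardBorelSpace E]
    [Nonempty E] {y : Ω → E} (hy : Measurable[past x₀ w t] y) {H : Ω → ℝ≥0∞}
    (hH : Measurable[past x₀ w t] H) {φ : E × Vec d → ℝ≥0∞} (hφ : Measurable φ)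
    {φ₀ b : E → ℝ≥0∞} (hφ₀ : Measurable φ₀) (hb : Measurable b)
    (hbound : ∀ᵐ ω ∂(μ[|attack w t]), ∀ z,
      ∫⁻ v, φ (z, v) ∂(lawGivenPastAttack μ x₀ w t X ω) ≤ b z)
    {G : Ω → ℝ≥0∞} (hG₀ : ∀ ω, w t ω = 0 → G ω ≤ φ₀ (y ω))
    (hG : ∀ᵐ ω ∂(μ[|attack w t]), G ω ≤ φ (y ω, X ω)) :
    ∫⁻ ω, H ω * G ω ∂μ
      ≤ ∫⁻ ω, H ω * (ENNReal.ofReal (1 - p) * φ₀ (y ω) + ENNReal.ofReal p * b (y ω)) ∂μ := by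
  have hle := past_le hx hw t
  have hS := measurableSet_attack hw t
  have hatt' := measure_attack hx hw hp1 hatt t
  have hne : μ (attack w t) ≠ 0 := by rw [hatt']; simpa using hp
  have hHm : Measurable H := hH.mono hle le_rfl
  have hym : Measurable y := hy.mono hle le_rfl
  rw [← lintegral_add_compl _ hS]
  have h1 : ∫⁻ ω in attack w t, H ω * G ω ∂μ
      ≤ ENNReal.ofReal p * ∫⁻ ω, H ω * b (y ω) ∂μ := by
    refine le_trans ?_ (setLIntegral_attack_le hx hw hp hp1 hatt t hX hy hH hφ hb hbound)
    rw [setLIntegral_eq_mul_cond hne, setLIntegral_eq_mul_cond hne]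
    gcongr 1
    refine lintegral_mono_ae ?_
    filter_upwards [hG] with ω hω
    gcongr
  have h2 : ∫⁻ ω in (attack w t)ᶜ, H ω * G ω ∂μ
      ≤ ENNReal.ofReal (1 - p) * ∫⁻ ω, H ω * φ₀ (y ω) ∂μ := by
    rw [← (setLIntegral_past hx hw hp1 hatt t (H := fun ω => H ω * φ₀ (y ω))
      (hH.mul (hφ₀.comp hy))).2]
    refine setLIntegral_mono' hS.compl ?_
    intro ω hω
    rw [compl_attack] at hω
    gcongr
    exact hG₀ ω hω
  refine (add_le_add h1 h2).trans ?_
  have hm1 : Measurable fun ω => H ω * b (y ω) := hHm.mul (hb.comp hym)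
  have hm2 : Measurable fun ω => H ω * φ₀ (y ω) := hHm.mul (hφ₀.comp hym)
  rw [← lintegral_const_mul _ hm1, ← lintegral_const_mul _ hm2,
    ← lintegral_add_left (hm1.const_mul _)]
  exact lintegral_mono fun ω => le_of_eq (by ring)

end Past

/-! ### One-dimensional marginals of the disturbances -/

section Marginals

lemma psi2Norm_le_imp {Ω : Type*} [MeasurableSpace Ω] {μ : Measure Ω} {X : Ω → ℝ} {σ : ℝ}
    (hσ : 0 < σ) (h : psi2Norm μ X ≤ ENNReal.ofReal σ) :
    ∫⁻ ω, ENNReal.ofReal (Real.exp (X ω ^ 2 / (2 * σ) ^ 2)) ∂μ ≤ 2 := by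
  have h1 : psi2Norm μ X < ENNReal.ofReal (2 * σ) :=
    h.trans_lt ((ENNReal.ofReal_lt_ofReal_iff (by linarith)).2 (by linarith))
  simp only [psi2Norm, iInf_lt_iff] at h1
  obtain ⟨c, ⟨hc, hc2⟩, hlt⟩ := h1
  have hcs : c < 2 * σ := (ENNReal.ofReal_lt_ofReal_iff (by linarith)).1 hlt
  refine le_trans (lintegral_mono fun ω => ?_) hc2
  gcongr

/-- All one-dimensional marginals of `ν` satisfy `E exp (⟨v, u⟩² / s²) ≤ 2`. Up to the factor `2`
in `s`, this is the bound `vecPsi2Norm ν ≤ s`, freed from the infimum. -/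
def ExpSqBound {d : ℕ} (ν : Measure (Vec d)) (s : ℝ) : Prop :=
  ∀ u : Vec d, ‖u‖ ≤ 1 → ∫⁻ v, ENNReal.ofReal (Real.exp (inner ℝ v u ^ 2 / s ^ 2)) ∂ν ≤ 2

lemma expSqBound_of_vecPsi2Norm_le {d : ℕ} {ν : Measure (Vec d)} {σ : ℝ} (hσ : 0 < σ)
    (h : vecPsi2Norm ν ≤ ENNReal.ofReal σ) : ExpSqBound ν (2 * σ) := fun u hu =>
  psi2Norm_le_imp hσ ((le_iSup₂ (f := fun (u : Vec d) (_ : ‖u‖ ≤ 1) =>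
    psi2Norm ν (fun v => inner ℝ v u)) u hu).trans h)

lemma exp_abs_le (a : ℝ) : Real.exp |a| ≤ Real.exp 1 * Real.exp (a ^ 2) := by
  rw [← Real.exp_add, Real.exp_le_exp]
  nlinarith [sq_abs a, sq_nonneg (|a| - 1), abs_nonneg a]

lemma ExpSqBound.exp_abs {d : ℕ} {ν : Measure (Vec d)} {s : ℝ} (h : ExpSqBound ν s)
    {u : Vec d} (hu : ‖u‖ ≤ 1) :
    ∫⁻ v, ENNReal.ofReal (Real.exp |inner ℝ v u / s|) ∂ν ≤ ENNReal.ofReal (2 * Real.exp 1) := by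
  calc ∫⁻ v, ENNReal.ofReal (Real.exp |inner ℝ v u / s|) ∂ν
      ≤ ∫⁻ v, ENNReal.ofReal (Real.exp 1) *
          ENNReal.ofReal (Real.exp (inner ℝ v u ^ 2 / s ^ 2)) ∂ν := by
        refine lintegral_mono fun v => ?_
        rw [← ENNReal.ofReal_mul (Real.exp_pos _).le, ← div_pow]
        exact ENNReal.ofReal_le_ofReal (exp_abs_le _)
    _ ≤ ENNReal.ofReal (Real.exp 1) * 2 := by
        rw [lintegral_const_mul _ (by fun_prop)]
        gcongr
        exact h u hu
    _ = ENNReal.ofReal (2 * Real.exp 1) := by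
        rw [mul_comm, ENNReal.ofReal_mul (by norm_num)]
        simp

variable {Ω : Type*} [MeasurableSpace Ω] {ν : Measure Ω} [IsProbabilityMeasure ν] {W : Ω → ℝ}
  {s : ℝ}

lemma moments_of_exp_sq (hW : Measurable W) (hs : 0 < s)
    (h : ∫⁻ ω, ENNReal.ofReal (Real.exp (W ω ^ 2 / s ^ 2)) ∂ν ≤ 2) :
    Integrable (fun ω => W ω ^ 2) ν ∧ Integrable (fun ω => W ω ^ 4) ν ∧
      ∫ ω, W ω ^ 2 ∂ν ≤ s ^ 2 ∧ ∫ ω, W ω ^ 4 ∂ν ≤ 2 * s ^ 4 := by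
  have hexp : Integrable (fun ω => Real.exp (W ω ^ 2 / s ^ 2)) ν := by
    refine ⟨by fun_prop, ?_⟩
    rw [hasFiniteIntegral_iff_ofReal (.of_forall fun ω => (Real.exp_pos _).le)]
    exact h.trans_lt (by norm_num)
  have hexp2 : ∫ ω, Real.exp (W ω ^ 2 / s ^ 2) ∂ν ≤ 2 := by
    rw [← ENNReal.ofReal_le_ofReal_iff (by norm_num), ofReal_integral_eq_lintegral_ofReal hexp
      (.of_forall fun ω => (Real.exp_pos _).le)]
    simpa using h
  have hq : ∀ ω, 1 + W ω ^ 2 / s ^ 2 + (W ω ^ 2 / s ^ 2) ^ 2 / 2 ≤ Real.exp (W ω ^ 2 / s ^ 2) :=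
    fun ω => Real.quadratic_le_exp_of_nonneg (by positivity)
  have hn : ∀ ω, 0 ≤ W ω ^ 2 / s ^ 2 := fun ω => by positivity
  have b2 : ∀ ω, W ω ^ 2 ≤ s ^ 2 * (Real.exp (W ω ^ 2 / s ^ 2) - 1) := by
    intro ω
    have e : W ω ^ 2 = s ^ 2 * (W ω ^ 2 / s ^ 2) := by field_simp
    have := hq ω
    calc W ω ^ 2 = s ^ 2 * (W ω ^ 2 / s ^ 2) := e
      _ ≤ _ := by gcongr; nlinarith [hn ω]
  have b4 : ∀ ω, W ω ^ 4 ≤ 2 * s ^ 4 * (Real.exp (W ω ^ 2 / s ^ 2) - 1) := by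
    intro ω
    have e : W ω ^ 4 = 2 * s ^ 4 * ((W ω ^ 2 / s ^ 2) ^ 2 / 2) := by field_simp
    have := hq ω
    calc W ω ^ 4 = 2 * s ^ 4 * ((W ω ^ 2 / s ^ 2) ^ 2 / 2) := e
      _ ≤ _ := by gcongr; nlinarith [hn ω]
  have i1 : Integrable (fun ω => Real.exp (W ω ^ 2 / s ^ 2) - 1) ν :=
    hexp.sub (integrable_const 1)
  have v1 : ∫ ω, (Real.exp (W ω ^ 2 / s ^ 2) - 1) ∂ν ≤ 1 := by
    rw [integral_sub hexp (integrable_const 1)]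
    simp; linarith
  have I2 : Integrable (fun ω => W ω ^ 2) ν := by
    refine (i1.const_mul (s ^ 2)).mono' (by fun_prop) (.of_forall fun ω => ?_)
    rw [Real.norm_of_nonneg (by positivity)]; exact b2 ω
  have I4 : Integrable (fun ω => W ω ^ 4) ν := by
    refine (i1.const_mul (2 * s ^ 4)).mono' (by fun_prop) (.of_forall fun ω => ?_)
    rw [Real.norm_of_nonneg (by positivity)]; exact b4 ω
  refine ⟨I2, I4, ?_, ?_⟩
  · refine (integral_mono I2 (i1.const_mul _) b2).trans ?_
    rw [integral_const_mul]
    nlinarith [sq_nonneg s]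
  · refine (integral_mono I4 (i1.const_mul _) b4).trans ?_
    rw [integral_const_mul]
    nlinarith [pow_pos hs 4]

lemma exp_neg_le_one_sub_half {x : ℝ} (h0 : 0 ≤ x) (h1 : x ≤ 1) :
    Real.exp (-x) ≤ 1 - x / 2 := by
  have h := Real.add_one_le_exp x
  rw [Real.exp_neg, inv_le_iff_one_le_mul₀ (Real.exp_pos _)]
  nlinarith

/-- A Paley–Zygmund estimate: if `W` has fourth moments of order `s⁴` and all its shifts
`c + W` have second moment at least `lam²`, then `c + W` is of order `lam` with probability of
order `(lam / s)⁴`, whatever the size of `c`. -/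
lemma smallBall_exp (hW : Measurable W) (hs : 0 < s)
    (h : ∫⁻ ω, ENNReal.ofReal (Real.exp (W ω ^ 2 / s ^ 2)) ∂ν ≤ 2) {lam : ℝ} (hl : 0 < lam)
    (hls : lam ≤ s) (c : ℝ) (hc : lam ^ 2 ≤ ∫ ω, (c + W ω) ^ 2 ∂ν) :
    ∫⁻ ω, ENNReal.ofReal (Real.exp (-min 1 ((c + W ω) ^ 2 / lam ^ 2))) ∂ν
      ≤ ENNReal.ofReal (1 - lam ^ 4 / (144 * s ^ 4) / 2) := by
  obtain ⟨I2, I4, m2, m4⟩ := moments_of_exp_sq hW hs h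
  have J2 : Integrable (fun ω => (c + W ω) ^ 2) ν := by
    refine ((I2.const_mul 2).add (integrable_const (2 * c ^ 2))).mono' (by fun_prop)
      (.of_forall fun ω => ?_)
    rw [Real.norm_of_nonneg (by positivity)]
    simp only [Pi.add_apply]
    nlinarith [sq_nonneg (c - W ω)]
  have p4 : ∀ ω, (c + W ω) ^ 4 ≤ 8 * W ω ^ 4 + 8 * c ^ 4 := by
    intro ω
    have h1 : (c + W ω) ^ 2 ≤ 2 * c ^ 2 + 2 * W ω ^ 2 := by nlinarith [sq_nonneg (c - W ω)]
    have h2 : ((c + W ω) ^ 2) ^ 2 ≤ (2 * c ^ 2 + 2 * W ω ^ 2) ^ 2 :=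
      pow_le_pow_left₀ (sq_nonneg _) h1 2
    nlinarith [sq_nonneg (c ^ 2 - W ω ^ 2)]
  have J4' : Integrable (fun ω => 8 * W ω ^ 4 + 8 * c ^ 4) ν :=
    (I4.const_mul 8).add (integrable_const (8 * c ^ 4))
  have J4 : Integrable (fun ω => (c + W ω) ^ 4) ν := by
    refine J4'.mono' (by fun_prop) (.of_forall fun ω => ?_)
    rw [Real.norm_of_nonneg (by positivity)]
    exact p4 ω
  set M2 := ∫ ω, (c + W ω) ^ 2 ∂ν with hM2
  set M4 := ∫ ω, (c + W ω) ^ 4 ∂ν with hM4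
  have hM4le : M4 ≤ 16 * s ^ 4 + 8 * c ^ 4 := by
    refine (integral_mono J4 J4' p4).trans ?_
    rw [integral_add (I4.const_mul 8) (integrable_const _), integral_const_mul]
    simp; linarith
  have hc2 : c ^ 2 ≤ 2 * M2 + 2 * s ^ 2 := by
    have : ∫ _ω, c ^ 2 ∂ν ≤ ∫ ω, (2 * (c + W ω) ^ 2 + 2 * W ω ^ 2) ∂ν := by
      refine integral_mono (integrable_const _) ((J2.const_mul 2).add (I2.const_mul 2)) fun ω => ?_
      simp only
      nlinarith [sq_nonneg (c + 2 * W ω)]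
    rw [integral_add (J2.const_mul 2) (I2.const_mul 2), integral_const_mul,
      integral_const_mul] at this
    simp at this
    linarith
  have hM2pos : 0 < M2 := lt_of_lt_of_le (by positivity) hc
  set q := lam ^ 4 / (144 * s ^ 4) with hq
  have hqpos : 0 < q := by positivity
  have hl4 : lam ^ 4 ≤ s ^ 4 := pow_le_pow_left₀ hl.le hls 4
  have hq1 : q ≤ 1 / 144 := by
    rw [hq, div_le_div_iff₀ (by positivity) (by norm_num)]; linarith
  have hqM : q * M4 ≤ M2 ^ 2 := by
    have h1 : c ^ 4 ≤ 8 * M2 ^ 2 + 8 * s ^ 4 := by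
      have h2 : (c ^ 2) ^ 2 ≤ (2 * M2 + 2 * s ^ 2) ^ 2 := pow_le_pow_left₀ (sq_nonneg _) hc2 2
      nlinarith [sq_nonneg (M2 - s ^ 2)]
    have h2 : M4 ≤ 64 * M2 ^ 2 + 80 * s ^ 4 := by linarith
    have h3 : lam ^ 4 ≤ M2 ^ 2 := by
      have := pow_le_pow_left₀ (by positivity) hc 2
      nlinarith
    calc q * M4 ≤ q * (64 * M2 ^ 2 + 80 * s ^ 4) := by gcongr
      _ = 64 * q * M2 ^ 2 + 80 / 144 * lam ^ 4 := by rw [hq]; field_simp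
      _ ≤ 64 * (1 / 144) * M2 ^ 2 + 80 / 144 * M2 ^ 2 := by gcongr
      _ = M2 ^ 2 := by ring
  -- The quadratic minorant `2 b z - b² z²` of `min 1 z` (for `b ≤ 1 / 2`), with the optimal `b`.
  set b := q * lam ^ 2 / M2 with hb
  have hb0 : 0 < b := by positivity
  have hb1 : b ≤ 1 / 2 := by
    rw [hb, div_le_iff₀ hM2pos]
    nlinarith [sq_nonneg lam]
  have hmin : ∀ z : ℝ, 0 ≤ z → 2 * b * z - b ^ 2 * z ^ 2 ≤ min 1 z := by
    intro z hz
    refine le_min (by nlinarith [sq_nonneg (1 - b * z)]) ?_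
    nlinarith [mul_nonneg (sq_nonneg b) (sq_nonneg z)]
  have hpt : ∀ ω, Real.exp (-min 1 ((c + W ω) ^ 2 / lam ^ 2))
      ≤ 1 - (b / lam ^ 2 * (c + W ω) ^ 2 - b ^ 2 / lam ^ 4 / 2 * (c + W ω) ^ 4) := by
    intro ω
    have hz : 0 ≤ (c + W ω) ^ 2 / lam ^ 2 := by positivity
    have h1 := exp_neg_le_one_sub_half (le_min zero_le_one hz) (min_le_left _ _)
    have h2 := hmin _ hz
    refine h1.trans ?_
    have e : 2 * b * ((c + W ω) ^ 2 / lam ^ 2) - b ^ 2 * ((c + W ω) ^ 2 / lam ^ 2) ^ 2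
        = 2 * (b / lam ^ 2 * (c + W ω) ^ 2 - b ^ 2 / lam ^ 4 / 2 * (c + W ω) ^ 4) := by
      field_simp
    linarith
  have K1 : Integrable (fun ω => b / lam ^ 2 * (c + W ω) ^ 2 -
      b ^ 2 / lam ^ 4 / 2 * (c + W ω) ^ 4) ν := (J2.const_mul _).sub (J4.const_mul _)
  have K2 : Integrable (fun ω => 1 - (b / lam ^ 2 * (c + W ω) ^ 2 -
      b ^ 2 / lam ^ 4 / 2 * (c + W ω) ^ 4)) ν := (integrable_const 1).sub K1
  refine (lintegral_mono fun ω => ENNReal.ofReal_le_ofReal (hpt ω)).trans ?_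
  rw [← ofReal_integral_eq_lintegral_ofReal K2
    (.of_forall fun ω => (Real.exp_pos _).le.trans (hpt ω))]
  refine ENNReal.ofReal_le_ofReal ?_
  rw [integral_sub (integrable_const _) K1, integral_sub (J2.const_mul _) (J4.const_mul _),
    integral_const_mul, integral_const_mul, ← hM2, ← hM4]
  simp only [integral_const, probReal_univ, smul_eq_mul, mul_one]
  have e1 : b / lam ^ 2 * M2 = q := by rw [hb]; field_simp
  have e2 : b ^ 2 / lam ^ 4 / 2 * M4 ≤ q / 2 := by
    have : b ^ 2 / lam ^ 4 / 2 * M4 = q / 2 * (q * M4) / M2 ^ 2 := by rw [hb]; field_simp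
    rw [this, div_le_iff₀ (by positivity)]
    gcongr
  linarith

lemma inner_single_one {d : ℕ} (v : Vec d) (i : Fin d) :
    inner ℝ v (EuclideanSpace.single i (1 : ℝ)) = v i := by
  simp [EuclideanSpace.inner_single_right]

/-- The matrix inequality in the non-degeneracy assumption, tested against a unit vector. -/
lemma le_integral_sq_of_posSemidef {d : ℕ} {ν : Measure (Vec d)} [IsProbabilityMeasure ν]
    (hs : 0 < s) (h : ExpSqBound ν s) {lam : ℝ}
    (hnd : ∀ x : Vec d, (shiftedSecondMoment ν x
      - lam ^ 2 • (1 : Matrix (Fin d) (Fin d) ℝ)).PosSemidef)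
    {u : Vec d} (hu : ‖u‖ = 1) (c : ℝ) :
    lam ^ 2 ≤ ∫ v, (c + inner ℝ v u) ^ 2 ∂ν := by
  have huu : ∑ i, u i * u i = 1 := by
    have := real_inner_self_eq_norm_sq u
    rw [hu, PiLp.inner_apply] at this
    simpa [← sq] using this
  have hcoord : ∀ i, MemLp (fun v : Vec d => c * u i + v i) 2 ν := by
    intro i
    have hv : MemLp (fun v : Vec d => v i) 2 ν := by
      rw [memLp_two_iff_integrable_sq (by fun_prop)]
      have := (moments_of_exp_sq
        (W := fun v : Vec d => inner ℝ v (EuclideanSpace.single i (1 : ℝ)))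
        (by fun_prop) hs (h _ (by simp))).1
      simpa only [inner_single_one] using this
    exact (memLp_const (c * u i)).add hv
  have hint : ∀ i j, Integrable (fun v : Vec d => (c * u i + v i) * (c * u j + v j)) ν :=
    fun i j => (hcoord i).integrable_mul (hcoord j)
  have hpos := (hnd (c • u)).dotProduct_mulVec_nonneg u.ofLp
  have hsq : ∀ v : Vec d, (c + inner ℝ v u) ^ 2
      = ∑ i, ∑ j, u i * u j * ((c * u i + v i) * (c * u j + v j)) := by
    intro v
    have h1 : ∑ i, u i * (c * u i) = c := by
      calc ∑ i, u i * (c * u i) = c * ∑ i, u i * u i := by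
            rw [Finset.mul_sum]
            exact Finset.sum_congr rfl fun i _ => by ring
        _ = c := by rw [huu, mul_one]
    have h2 : inner ℝ v u = ∑ i, u i * v i := by
      simp [PiLp.inner_apply]
    have : c + inner ℝ v u = ∑ i, u i * (c * u i + v i) := by
      simp only [mul_add, Finset.sum_add_distrib]
      rw [h1, h2]
    rw [this, sq, Finset.sum_mul_sum]
    exact Finset.sum_congr rfl fun i _ => Finset.sum_congr rfl fun j _ => by ring
  have hI : ∫ v, (c + inner ℝ v u) ^ 2 ∂ν
      = ∑ i, ∑ j, u i * u j * ∫ v, (c * u i + v i) * (c * u j + v j) ∂ν := by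
    simp_rw [hsq]
    rw [integral_finsetSum _ fun i _ => integrable_finsetSum _ fun j _ => (hint i j).const_mul _]
    refine Finset.sum_congr rfl fun i _ => ?_
    rw [integral_finsetSum _ fun j _ => (hint i j).const_mul _]
    exact Finset.sum_congr rfl fun j _ => integral_const_mul _ _
  have hexp : star u.ofLp ⬝ᵥ (shiftedSecondMoment ν (c • u)
      - lam ^ 2 • (1 : Matrix (Fin d) (Fin d) ℝ)).mulVec u.ofLp
      = (∑ i, ∑ j, u i * u j * ∫ v, (c * u i + v i) * (c * u j + v j) ∂ν) - lam ^ 2 := by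
    rw [Matrix.sub_mulVec, dotProduct_sub, Matrix.smul_mulVec, Matrix.one_mulVec]
    congr 1
    · simp only [dotProduct, Matrix.mulVec, shiftedSecondMoment, Matrix.of_apply, star_trivial,
        Finset.mul_sum, PiLp.smul_apply, smul_eq_mul]
      exact Finset.sum_congr rfl fun i _ => Finset.sum_congr rfl fun j _ => by ring
    · rw [dotProduct_smul, star_trivial]
      simp only [dotProduct, huu, smul_eq_mul, mul_one]
  rw [hexp] at hpos
  rw [hI]
  linarith

lemma le_of_posSemidef {d : ℕ} (hd : 0 < d) {ν : Measure (Vec d)} [IsProbabilityMeasure ν]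
    (hs : 0 < s) (h : ExpSqBound ν s) {lam : ℝ} (hnd : ∀ x : Vec d, (shiftedSecondMoment ν x
      - lam ^ 2 • (1 : Matrix (Fin d) (Fin d) ℝ)).PosSemidef) :
    lam ≤ s := by
  have hu : ‖(EuclideanSpace.single (⟨0, hd⟩ : Fin d) (1 : ℝ) : Vec d)‖ = 1 := by simp
  have h1 := le_integral_sq_of_posSemidef hs h hnd hu 0
  have h2 := (moments_of_exp_sq (by fun_prop) hs (h _ hu.le)).2.2.1
  simp only [zero_add] at h1
  exact le_of_sq_le_sq (h1.trans h2) hs.le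

end Marginals

/-! ### Exponential moments along the trajectory -/

lemma exp_le_add_exp_sq (x : ℝ) : Real.exp x ≤ x + Real.exp (x ^ 2) := by
  have h2 := Real.add_one_le_exp (x ^ 2)
  rcases le_total |x| 1 with h | h
  · have := (abs_le.1 (Real.abs_exp_sub_one_sub_id_le h)).2
    linarith
  · rcases le_total 0 x with hx | hx
    · rw [abs_of_nonneg hx] at h
      have : Real.exp x ≤ Real.exp (x ^ 2) := Real.exp_le_exp.2 (by nlinarith)
      linarith
    · rw [abs_of_nonpos hx] at h
      have : Real.exp x ≤ 1 := Real.exp_le_one_iff.2 hx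
      nlinarith

/-- A Hoeffding-type bound for the variable taking the value `-b` with probability `1 - p` and
`± b` with probability `p / 2` each, whose mean is `-(1 - p) b`. -/
lemma three_point_mgf_le {p b : ℝ} (hp : 0 < p) (hp1 : p < 1) :
    (1 - p) * Real.exp (-b) + p * Real.cosh b ≤ Real.exp (4 * b ^ 2 - (1 - p) * b) := by
  -- After centring, the values are `-p b` and `(2 - p) b`, which are at most `2 |b|` in size.
  have h1 := exp_le_add_exp_sq (-p * b)
  have h2 := exp_le_add_exp_sq ((2 - p) * b)
  have e1 : Real.exp ((-p * b) ^ 2) ≤ Real.exp (4 * b ^ 2) :=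
    Real.exp_le_exp.2 (by nlinarith [sq_nonneg b])
  have e2 : Real.exp (((2 - p) * b) ^ 2) ≤ Real.exp (4 * b ^ 2) :=
    Real.exp_le_exp.2 (by nlinarith [sq_nonneg b, mul_nonneg hp.le (sq_nonneg b)])
  have key : (1 - p / 2) * Real.exp (-p * b) + p / 2 * Real.exp ((2 - p) * b)
      ≤ Real.exp (4 * b ^ 2) := by
    nlinarith [mul_le_mul_of_nonneg_left (h1.trans (add_le_add_right e1 _))
        (show 0 ≤ 1 - p / 2 by linarith),
      mul_le_mul_of_nonneg_left (h2.trans (add_le_add_right e2 _)) (show 0 ≤ p / 2 by linarith)]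
  rw [show 4 * b ^ 2 - (1 - p) * b = 4 * b ^ 2 + -((1 - p) * b) by ring, Real.exp_add]
  have f1 : Real.exp (-b) = Real.exp (-p * b) * Real.exp (-((1 - p) * b)) := by
    rw [← Real.exp_add]; congr 1; ring
  have f2 : Real.exp b = Real.exp ((2 - p) * b) * Real.exp (-((1 - p) * b)) := by
    rw [← Real.exp_add]; congr 1; ring
  rw [Real.cosh_eq, f1, f2]
  nlinarith [mul_le_mul_of_nonneg_right key (Real.exp_pos (-((1 - p) * b))).le]

/-- If each coordinate law is sign-symmetric, the moment generating function of the sign is at most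
`cosh`. -/
lemma lintegral_exp_sign_le {d : ℕ} {ν : Measure (Vec d)} [IsProbabilityMeasure ν] (i : Fin d)
    (h : ν {v | 0 < v i} = ν {v | v i < 0}) (a : ℝ) :
    ∫⁻ v, ENNReal.ofReal (Real.exp (Real.sign (v i) * a)) ∂ν ≤ ENNReal.ofReal (Real.cosh a) := by
  set P : Set (Vec d) := {v | 0 < v i}
  set N : Set (Vec d) := {v | v i < 0}
  have mP : MeasurableSet P := measurableSet_lt measurable_const (by fun_prop)
  have mN : MeasurableSet N := measurableSet_lt (by fun_prop) measurable_const
  have hd : Disjoint P N := Set.disjoint_left.2 fun v (h1 : 0 < v i) (h2 : v i < 0) => by linarith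
  have hsum : ν P + ν N + ν (P ∪ N)ᶜ = 1 := by
    rw [← measure_union hd mN, measure_add_measure_compl (mP.union mN), measure_univ]
  have hle : ∀ v : Vec d, ENNReal.ofReal (Real.exp (Real.sign (v i) * a))
      ≤ P.indicator (fun _ => ENNReal.ofReal (Real.exp a)) v
        + N.indicator (fun _ => ENNReal.ofReal (Real.exp (-a))) v
        + (P ∪ N)ᶜ.indicator (fun _ => ENNReal.ofReal (Real.cosh a)) v := by
    intro v
    rcases lt_trichotomy (v i) 0 with hv | hv | hv
    · have : v ∈ N := hv
      simp [this, Real.sign_of_neg hv]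
    · have h1 : v ∉ P := fun h' : 0 < v i => by linarith
      have h2 : v ∉ N := fun h' : v i < 0 => by linarith
      simp only [hv, Real.sign_zero, zero_mul, Real.exp_zero, h1, h2, not_false_eq_true,
        Set.indicator_of_notMem, zero_add, Set.mem_compl_iff, Set.mem_union, or_self,
        Set.indicator_of_mem]
      exact ENNReal.ofReal_le_ofReal (Real.one_le_cosh a)
    · have : v ∈ P := hv
      simp [this, Real.sign_of_pos hv]
  refine (lintegral_mono hle).trans ?_
  have m1 : Measurable (P.indicator fun _ => ENNReal.ofReal (Real.exp a)) :=
    measurable_const.indicator mP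
  have m2 : Measurable (N.indicator fun _ => ENNReal.ofReal (Real.exp (-a))) :=
    measurable_const.indicator mN
  have m12 : Measurable fun v => P.indicator (fun _ => ENNReal.ofReal (Real.exp a)) v
      + N.indicator (fun _ => ENNReal.ofReal (Real.exp (-a))) v := m1.add m2
  rw [lintegral_add_left m12, lintegral_add_left m1, lintegral_indicator_const mP,
    lintegral_indicator_const mN, lintegral_indicator_const (mP.union mN).compl]
  have hc : ENNReal.ofReal (Real.exp a) * ν P + ENNReal.ofReal (Real.exp (-a)) * ν N
      = ENNReal.ofReal (Real.cosh a) * (ν P + ν N) := by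
    rw [← h, ← add_mul, ← ENNReal.ofReal_add (Real.exp_pos _).le (Real.exp_pos _).le,
      ← two_mul, ← mul_assoc]
    congr 1
    rw [mul_comm, ← ENNReal.ofReal_ofNat, ← ENNReal.ofReal_mul (by norm_num), Real.cosh_eq]
    congr 1; ring
  rw [hc, ← mul_add, hsum, mul_one]

section Slope

variable {d : ℕ}

/-- A lower bound for the growth `|v i - y| - |v i|` of the `i`-th residual: `|y|` without attack
(`v = 0`), and the linear bound `-sign (v i) y` at an attack. -/
def signSlope (v : Vec d) (i : Fin d) (y : ℝ) : ℝ :=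
  if v = 0 then |y| else -(Real.sign (v i) * y)

lemma measurable_real_sign : Measurable Real.sign :=
  Measurable.ite (measurableSet_lt measurable_id measurable_const) measurable_const
    (Measurable.ite (measurableSet_lt measurable_const measurable_id) measurable_const
      measurable_const)

/-- The exponent of the supermartingale controlling the sum of the slopes: `-θ` times the slope, its
conditional mean, and a bound for its conditional variance. -/
def slopeExponent (p θ : ℝ) (v : Vec d) (i : Fin d) (y : ℝ) : ℝ :=
  -θ * signSlope v i y + (θ * (1 - p) * |y| - 4 * θ ^ 2 * y ^ 2)

lemma measurable_slopeExponent (p θ : ℝ) (i : Fin d) :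
    Measurable fun z : Vec d × ℝ => slopeExponent p θ z.1 i z.2 := by
  have hsm : Measurable fun z : Vec d × ℝ => signSlope z.1 i z.2 := by
    refine Measurable.ite (measurable_fst (measurableSet_singleton 0)) (by fun_prop) ?_
    exact ((measurable_real_sign.comp (by fun_prop)).mul measurable_snd).neg
  unfold slopeExponent
  fun_prop

lemma slope_step_le_one {p θ : ℝ} (hp : 0 < p) (hp1 : p < 1) (hθ : 0 ≤ θ) (z : ℝ) :
    ENNReal.ofReal (1 - p) * (ENNReal.ofReal (Real.exp (-(θ * |z|)))
        * ENNReal.ofReal (Real.exp (θ * (1 - p) * |z| - 4 * θ ^ 2 * z ^ 2)))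
      + ENNReal.ofReal p * (ENNReal.ofReal (Real.cosh (θ * z))
        * ENNReal.ofReal (Real.exp (θ * (1 - p) * |z| - 4 * θ ^ 2 * z ^ 2))) ≤ 1 := by
  rw [← mul_assoc, ← mul_assoc, ← add_mul, ← ENNReal.ofReal_mul (by linarith),
    ← ENNReal.ofReal_mul hp.le, ← ENNReal.ofReal_add
      (mul_nonneg (by linarith) (Real.exp_pos _).le) (mul_nonneg hp.le (Real.cosh_pos _).le),
    ← ENNReal.ofReal_mul (add_nonneg
      (mul_nonneg (by linarith) (Real.exp_pos _).le) (mul_nonneg hp.le (Real.cosh_pos _).le))]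
  refine ENNReal.ofReal_le_one.2 ?_
  have h1 := three_point_mgf_le (b := θ * |z|) hp hp1
  have h2 : Real.cosh (θ * z) = Real.cosh (θ * |z|) := by
    rw [← Real.cosh_abs, abs_mul, abs_of_nonneg hθ]
  have h3 : Real.exp (4 * (θ * |z|) ^ 2 - (1 - p) * (θ * |z|))
      * Real.exp (θ * (1 - p) * |z| - 4 * θ ^ 2 * z ^ 2) = 1 := by
    rw [← Real.exp_add, ← Real.exp_zero]
    congr 1
    rw [mul_pow, sq_abs]; ring
  rw [h2]
  exact (mul_le_mul_of_nonneg_right h1 (Real.exp_pos _).le).trans h3.le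

end Slope

/-- Markov's inequality for the exponential of `X`. -/
lemma measure_ge_le_of_lintegral_exp {Ω : Type*} [MeasurableSpace Ω] {μ : Measure Ω} {X : Ω → ℝ}
    (hX : Measurable X) {K : ℝ}
    (h : ∫⁻ ω, ENNReal.ofReal (Real.exp (X ω)) ∂μ ≤ ENNReal.ofReal K) (b : ℝ) :
    μ {ω | b ≤ X ω} ≤ ENNReal.ofReal (K * Real.exp (-b)) := by
  have h1 := meas_ge_le_lintegral_div (μ := μ) (f := fun ω => ENNReal.ofReal (Real.exp (X ω)))
    (by fun_prop) (ε := ENNReal.ofReal (Real.exp b)) (by simp [Real.exp_pos]) (by simp)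
  have h2 : {ω | b ≤ X ω} ⊆ {ω | ENNReal.ofReal (Real.exp b) ≤ ENNReal.ofReal (Real.exp (X ω))} :=
    fun ω (hω : b ≤ X ω) => ENNReal.ofReal_le_ofReal (Real.exp_le_exp.2 hω)
  refine (measure_mono h2).trans (h1.trans ?_)
  rw [Real.exp_neg, ← div_eq_mul_inv, ENNReal.ofReal_div_of_pos (Real.exp_pos _)]
  gcongr

/-- The assumptions of the theorem, with the sub-Gaussian norm bounds in the form `ExpSqBound`. -/
structure AttackModel {d : ℕ} {Ω : Type*} [MeasurableSpace Ω] (μ : Measure Ω)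
    [IsProbabilityMeasure μ] (x₀ : Ω → Vec d) (w : ℕ → Ω → Vec d) (p s lam : ℝ) : Prop where
  meas_init : Measurable x₀
  meas_noise : ∀ t, Measurable (w t)
  p_pos : 0 < p
  p_lt_one : p < 1
  s_pos : 0 < s
  lam_pos : 0 < lam
  lam_le : lam ≤ s
  init : ExpSqBound (μ.map x₀) s
  noise : ∀ t, ∀ᵐ ω ∂(μ[|attack w t]), ExpSqBound (lawGivenPastAttack μ x₀ w t (w t) ω) s
  att : ProbabilisticAttack μ x₀ w p
  nondeg : NonDegenerate μ x₀ w lam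
  signs : SignRestricted μ x₀ w

instance {d : ℕ} {Ω : Type*} [MeasurableSpace Ω] (μ : Measure Ω) [IsProbabilityMeasure μ]
    (x₀ : Ω → Vec d) (w : ℕ → Ω → Vec d) (t : ℕ) (X : Ω → Vec d) (ω : Ω) :
    IsProbabilityMeasure (lawGivenPastAttack μ x₀ w t X ω) := by
  unfold lawGivenPastAttack; infer_instance

namespace AttackModel

variable {d : ℕ} {Ω : Type*} [MeasurableSpace Ω] {μ : Measure Ω} [IsProbabilityMeasure μ]
  {x₀ : Ω → Vec d} {w : ℕ → Ω → Vec d} {p s lam : ℝ}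

/-- Exponential moments of functionals that add up over the initial state and the disturbances in
a fixed direction; steps without attack contribute a factor `φ 0 = 1`. -/
lemma lintegral_prod_le (M : AttackModel μ x₀ w p s lam) {φ : ℝ → ℝ≥0∞} (hφ : Measurable φ)
    (h0 : φ 0 = 1) (u : Vec d) {b : ℝ≥0∞}
    (hb : ∀ ν : Measure (Vec d), ExpSqBound ν s → ∫⁻ v, φ (inner ℝ v u) ∂ν ≤ b) (n : ℕ) :
    ∫⁻ ω, φ (inner ℝ (x₀ ω) u) * ∏ k ∈ Finset.range n, φ (inner ℝ (w k ω) u) ∂μ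
      ≤ b * (ENNReal.ofReal (1 - p) + ENNReal.ofReal p * b) ^ n := by
  have hφu : Measurable fun v : Vec d => φ (inner ℝ v u) := hφ.comp (by fun_prop)
  induction n with
  | zero =>
    simp only [Finset.range_zero, Finset.prod_empty, mul_one, pow_zero]
    have := hb _ M.init
    rwa [lintegral_map hφu M.meas_init] at this
  | succ n ih =>
    have hH : Measurable[past x₀ w n]
        fun ω => φ (inner ℝ (x₀ ω) u) * ∏ k ∈ Finset.range n, φ (inner ℝ (w k ω) u) := by
      refine Measurable.mul (hφu.comp (measurable_past_init n)) ?_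
      exact Finset.measurable_fun_prod _ fun k hk =>
        hφu.comp (measurable_past_noise (Finset.mem_range.1 hk))
    have step := lintegral_step_le M.meas_init M.meas_noise M.p_pos M.p_lt_one M.att n
      (M.meas_noise n) (y := fun _ => (0 : ℝ)) measurable_const hH
      (φ := fun z => φ (inner ℝ z.2 u)) (hφu.comp measurable_snd) (φ₀ := fun _ => 1)
      (b := fun _ => b) measurable_const measurable_const
      (by filter_upwards [M.noise n] with ω hω z using hb _ hω)
      (G := fun ω => φ (inner ℝ (w n ω) u)) (by intro ω hω; simp [hω, h0])
      (.of_forall fun ω => le_rfl)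
    simp_rw [Finset.prod_range_succ, ← mul_assoc]
    refine step.trans ?_
    have hHm := hH.mono (past_le M.meas_init M.meas_noise n) le_rfl
    rw [lintegral_mul_const _ hHm, mul_one, pow_succ, ← mul_assoc]
    gcongr

/-- The energy of the next state in direction `u`, truncated at scale `lam`, and counted at attack
times only. -/
def truncEnergy (A : Matrix (Fin d) (Fin d) ℝ) (x₀ : Ω → Vec d) (w : ℕ → Ω → Vec d) (lam : ℝ)
    (u : Vec d) (t : ℕ) : Ω → ℝ :=
  (attack w t).indicator fun ω =>
    min 1 (proj A x₀ w u (t + 1) ω ^ 2 / lam ^ 2)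

/-- At each time, an attack happens with probability `p`, and then the small-ball estimate applies to
`⟨A x_t, u⟩ + ⟨w_t, u⟩` conditionally on the past, whatever the value of `x_t`. -/
lemma lintegral_exp_truncEnergy_le (M : AttackModel μ x₀ w p s lam)
    (A : Matrix (Fin d) (Fin d) ℝ) {u : Vec d} (hu : ‖u‖ = 1) (n : ℕ) :
    ∫⁻ ω, ENNReal.ofReal (Real.exp (∑ t ∈ Finset.range n, -truncEnergy A x₀ w lam u t ω)) ∂μ
      ≤ ENNReal.ofReal (1 - p * (lam ^ 4 / (144 * s ^ 4)) / 2) ^ n := by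
  have hq : lam ^ 4 / (144 * s ^ 4) ≤ 1 := by
    have := M.s_pos
    have := M.lam_pos
    rw [div_le_one (by positivity)]
    have : lam ^ 4 ≤ s ^ 4 := pow_le_pow_left₀ M.lam_pos.le M.lam_le 4
    nlinarith [pow_pos M.s_pos 4]
  set q := lam ^ 4 / (144 * s ^ 4)
  have hp := M.p_pos
  have hp1 := M.p_lt_one
  have hmeas : ∀ t, Measurable[past x₀ w (t + 1)] (truncEnergy A x₀ w lam u t) := by
    intro t
    refine Measurable.indicator ?_ ?_
    · exact (show Measurable fun z : ℝ => min 1 (z ^ 2 / lam ^ 2) by fun_prop).comp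
        (measurable_past_proj A u le_rfl)
    · exact (measurable_past_noise (Nat.lt_succ_self t)) (measurableSet_singleton 0).compl
  induction n with
  | zero => simp
  | succ n ih =>
    have hH : Measurable[past x₀ w n] fun ω => ENNReal.ofReal
        (Real.exp (∑ t ∈ Finset.range n, -truncEnergy A x₀ w lam u t ω)) := by
      refine ENNReal.measurable_ofReal.comp (Real.measurable_exp.comp ?_)
      refine Finset.measurable_fun_sum _ fun t ht => ?_
      exact ((hmeas t).mono (past_mono (Finset.mem_range.1 ht)) le_rfl).neg
    have hy : Measurable[past x₀ w n]
        fun ω => inner ℝ (matCLM A (trajectory A (x₀ ω) (fun k => w k ω) n)) u :=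
      (show Measurable fun x : Vec d => inner ℝ (matCLM A x) u by fun_prop).comp
        (measurable_past_trajectory A le_rfl)
    have step := lintegral_step_le M.meas_init M.meas_noise M.p_pos M.p_lt_one M.att n
      (M.meas_noise n) hy hH
      (φ := fun z => ENNReal.ofReal (Real.exp (-min 1 ((z.1 + inner ℝ z.2 u) ^ 2 / lam ^ 2))))
      (by fun_prop) (φ₀ := fun _ => 1)
      (b := fun _ => ENNReal.ofReal (1 - q / 2)) measurable_const measurable_const
      (by
        filter_upwards [M.noise n, M.nondeg n] with ω h1 h2 z
        exact smallBall_exp (by fun_prop) M.s_pos (h1 u hu.le) M.lam_pos M.lam_le z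
          (le_integral_sq_of_posSemidef M.s_pos h1 h2 hu z))
      (G := fun ω => ENNReal.ofReal (Real.exp (-truncEnergy A x₀ w lam u n ω)))
      (by intro ω hω; simp [truncEnergy, attack, hω])
      (by
        filter_upwards [ae_cond_mem (measurableSet_attack M.meas_noise n)] with ω hω
        simp [truncEnergy, hω, proj, trajectory, inner_add_left])
    simp_rw [Finset.sum_range_succ, Real.exp_add, ENNReal.ofReal_mul (Real.exp_pos _).le]
    refine step.trans ?_
    have hHm := hH.mono (past_le M.meas_init M.meas_noise n) le_rfl
    rw [lintegral_mul_const _ hHm, mul_one, pow_succ, ← ENNReal.ofReal_mul hp.le,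
      ← ENNReal.ofReal_add (by linarith) (mul_nonneg hp.le (by linarith))]
    gcongr
    linarith

/-- The exponential supermartingale of the slopes: without attack the slope is `|y_t|`, and at an
attack its conditional exponential moment is at most a `cosh` by sign symmetry. The sign of `w_t i`
is replaced by that of `α_t i`, about which the assumption speaks. -/
lemma lintegral_exp_slope_le (M : AttackModel μ x₀ w p s lam) (A : Matrix (Fin d) (Fin d) ℝ)
    (u : Vec d) (i : Fin d) {θ : ℝ} (hθ : 0 ≤ θ) (n : ℕ) :
    ∫⁻ ω, ENNReal.ofReal (Real.exp (∑ t ∈ Finset.range n,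
      slopeExponent p θ (w t ω) i (proj A x₀ w u t ω))) ∂μ ≤ 1 := by
  obtain ⟨α, β, hα, hβ, hαβ⟩ := M.signs
  have hsg : Measurable fun v : Vec d => Real.sign (v i) := measurable_real_sign.comp (by fun_prop)
  induction n with
  | zero => simp
  | succ n ih =>
    have hH : Measurable[past x₀ w n] fun ω => ENNReal.ofReal (Real.exp (∑ t ∈ Finset.range n,
        slopeExponent p θ (w t ω) i (proj A x₀ w u t ω))) := by
      refine ENNReal.measurable_ofReal.comp (Real.measurable_exp.comp ?_)
      refine Finset.measurable_fun_sum _ fun t ht => ?_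
      have ht' := Finset.mem_range.1 ht
      exact (measurable_slopeExponent p θ i).comp
        ((measurable_past_noise ht').prodMk (measurable_past_proj A u ht'.le))
    have hexp : Measurable fun z : ℝ =>
        ENNReal.ofReal (Real.exp (θ * (1 - p) * |z| - 4 * θ ^ 2 * z ^ 2)) := by fun_prop
    have hφ : Measurable fun z : ℝ × Vec d =>
        ENNReal.ofReal (Real.exp (Real.sign (z.2 i) * (θ * z.1)))
          * ENNReal.ofReal (Real.exp (θ * (1 - p) * |z.1| - 4 * θ ^ 2 * z.1 ^ 2)) := by
      refine Measurable.mul ?_ (hexp.comp measurable_fst)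
      exact ENNReal.measurable_ofReal.comp (Real.measurable_exp.comp
        ((hsg.comp measurable_snd).mul (measurable_fst.const_mul θ)))
    have hb : ∀ᵐ ω ∂(μ[|attack w n]), ∀ z : ℝ,
        ∫⁻ v, ENNReal.ofReal (Real.exp (Real.sign (v i) * (θ * z)))
          * ENNReal.ofReal (Real.exp (θ * (1 - p) * |z| - 4 * θ ^ 2 * z ^ 2))
            ∂(lawGivenPastAttack μ x₀ w n (α n) ω)
        ≤ ENNReal.ofReal (Real.cosh (θ * z))
          * ENNReal.ofReal (Real.exp (θ * (1 - p) * |z| - 4 * θ ^ 2 * z ^ 2)) := by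
      filter_upwards [(hαβ n).2.2.1 i] with ω hω z
      have hm : Measurable fun v : Vec d =>
          ENNReal.ofReal (Real.exp (Real.sign (v i) * (θ * z))) :=
        ENNReal.measurable_ofReal.comp (Real.measurable_exp.comp (hsg.mul_const _))
      rw [lintegral_mul_const _ hm]
      gcongr
      exact lintegral_exp_sign_le i hω _
    have hG₀ : ∀ ω, w n ω = 0 →
        ENNReal.ofReal (Real.exp (slopeExponent p θ (w n ω) i (proj A x₀ w u n ω)))
        ≤ ENNReal.ofReal (Real.exp (-(θ * |proj A x₀ w u n ω|)))
          * ENNReal.ofReal (Real.exp (θ * (1 - p) * |proj A x₀ w u n ω|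
              - 4 * θ ^ 2 * proj A x₀ w u n ω ^ 2)) := by
      intro ω hω
      rw [← ENNReal.ofReal_mul (Real.exp_pos _).le, ← Real.exp_add]
      refine le_of_eq ?_
      simp only [slopeExponent, signSlope, hω, if_true, neg_mul]
    have hG : ∀ᵐ ω ∂(μ[|attack w n]),
        ENNReal.ofReal (Real.exp (slopeExponent p θ (w n ω) i (proj A x₀ w u n ω)))
        ≤ ENNReal.ofReal (Real.exp (Real.sign (α n ω i) * (θ * proj A x₀ w u n ω)))
          * ENNReal.ofReal (Real.exp (θ * (1 - p) * |proj A x₀ w u n ω|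
              - 4 * θ ^ 2 * proj A x₀ w u n ω ^ 2)) := by
      obtain ⟨B, -, hB⟩ := (hαβ n).2.2.2 i
      filter_upwards [ae_cond_mem (measurableSet_attack M.meas_noise n), (hαβ n).1, hB]
        with ω h1 h2 h3
      rw [← ENNReal.ofReal_mul (Real.exp_pos _).le, ← Real.exp_add]
      refine le_of_eq ?_
      have hsign : Real.sign (w n ω i) = Real.sign (α n ω i) := by
        rw [h2 i]
        rcases lt_trichotomy (α n ω i) 0 with h | h | h
        · rw [Real.sign_of_neg h, Real.sign_of_neg (mul_neg_of_neg_of_pos h h3.1)]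
        · rw [h, zero_mul]
        · rw [Real.sign_of_pos h, Real.sign_of_pos (mul_pos h h3.1)]
      have h1' : w n ω ≠ 0 := h1
      simp only [slopeExponent, signSlope, h1', if_false, hsign]
      congr 2; ring
    have step := lintegral_step_le M.meas_init M.meas_noise M.p_pos M.p_lt_one M.att n
      (hα n) (measurable_past_proj A u le_rfl) hH hφ
      (φ₀ := fun z => ENNReal.ofReal (Real.exp (-(θ * |z|)))
        * ENNReal.ofReal (Real.exp (θ * (1 - p) * |z| - 4 * θ ^ 2 * z ^ 2)))
      (b := fun z => ENNReal.ofReal (Real.cosh (θ * z))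
        * ENNReal.ofReal (Real.exp (θ * (1 - p) * |z| - 4 * θ ^ 2 * z ^ 2)))
      (Measurable.mul (by fun_prop) hexp) (Measurable.mul (by fun_prop) hexp) hb hG₀ hG
    simp_rw [Finset.sum_range_succ, Real.exp_add, ENNReal.ofReal_mul (Real.exp_pos _).le]
    exact step.trans (le_trans (lintegral_mono fun ω =>
      mul_le_of_le_one_right' (slope_step_le_one M.p_pos M.p_lt_one hθ _)) ih)

end AttackModel

/-! ### The trajectory as a sum over past disturbances -/

section Unrolling

variable {d : ℕ} (A : Matrix (Fin d) (Fin d) ℝ) (x₀ : Vec d) (w : ℕ → Vec d)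

/-- The inputs of the system in order: the initial state followed by the disturbances. -/
def inputs : ℕ → Vec d
  | 0 => x₀
  | t + 1 => w t

lemma inner_trajectory_eq_sum (t : ℕ) (u : Vec d) :
    inner ℝ (trajectory A x₀ w t) u = ∑ k ∈ Finset.range (t + 1),
      inner ℝ (inputs x₀ w (t - k)) (((matCLM A).adjoint ^ k) u) := by
  induction t generalizing u with
  | zero => simp [trajectory, inputs]
  | succ t ih =>
    rw [Finset.sum_range_succ', trajectory, inner_add_left,
      ← ContinuousLinearMap.adjoint_inner_right, ih]
    simp [inputs, pow_succ]

/-- The adjoint powers applied to a unit vector are `‖A‖ ^ k` times vectors of the unit ball. -/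
lemma exists_dir {u : Vec d} (hu : ‖u‖ ≤ 1) : ∃ v : ℕ → Vec d, (∀ k, ‖v k‖ ≤ 1) ∧
    ∀ k, ((matCLM A).adjoint ^ k) u = ‖matCLM A‖ ^ k • v k := by
  have hn : ∀ k, ‖((matCLM A).adjoint ^ k) u‖ ≤ ‖matCLM A‖ ^ k := by
    intro k
    induction k with
    | zero => simpa using hu
    | succ k ih =>
      rw [pow_succ', mul_apply_eq_comp, pow_succ']
      refine (ContinuousLinearMap.le_opNorm _ _).trans ?_
      rw [LinearIsometryEquiv.norm_map]
      gcongr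
  refine ⟨fun k => (‖matCLM A‖ ^ k)⁻¹ • ((matCLM A).adjoint ^ k) u, fun k => ?_, fun k => ?_⟩
  · rw [norm_smul, norm_inv, norm_pow, norm_norm]
    exact inv_mul_le_one_of_le₀ (hn k) (by positivity)
  · by_cases h0 : ‖matCLM A‖ ^ k = 0
    · have := hn k
      rw [h0] at this
      simpa [h0] using this
    · rw [smul_inv_smul₀ h0]

lemma geom_sum_le_inv {ρ : ℝ} (h0 : 0 ≤ ρ) (h1 : ρ < 1) (n : ℕ) :
    ∑ k ∈ Finset.range n, ρ ^ k ≤ 1 / (1 - ρ) := by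
  rw [le_div_iff₀ (by linarith), geom_sum_mul_neg]
  linarith [pow_nonneg h0 n]

/-- Young's convolution inequality, by Cauchy–Schwarz. -/
lemma sum_inner_trajectory_sq_le (hA : ‖matCLM A‖ < 1) {u : Vec d} {v : ℕ → Vec d}
    (hv : ∀ k, ((matCLM A).adjoint ^ k) u = ‖matCLM A‖ ^ k • v k) (n : ℕ) :
    ∑ t ∈ Finset.range n, inner ℝ (trajectory A x₀ w t) u ^ 2
      ≤ 1 / (1 - ‖matCLM A‖) * ∑ k ∈ Finset.range n, ‖matCLM A‖ ^ k *
          (inner ℝ x₀ (v k) ^ 2 + ∑ j ∈ Finset.range n, inner ℝ (w j) (v k) ^ 2) := by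
  set ρ := ‖matCLM A‖ with hρ
  have h0 : 0 ≤ ρ := norm_nonneg _
  have h1 : ∀ t, inner ℝ (trajectory A x₀ w t) u ^ 2 ≤ 1 / (1 - ρ) *
      ∑ k ∈ Finset.range (t + 1), ρ ^ k * inner ℝ (inputs x₀ w (t - k)) (v k) ^ 2 := by
    intro t
    rw [inner_trajectory_eq_sum]
    refine (Finset.sum_sq_le_sum_mul_sum_of_sq_le_mul (Finset.range (t + 1))
      (f := fun k => ρ ^ k) (g := fun k => ρ ^ k * inner ℝ (inputs x₀ w (t - k)) (v k) ^ 2)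
      (fun k _ => by positivity) (fun k _ => by positivity) (fun k _ => ?_)).trans ?_
    · rw [hv, inner_smul_right]
      exact le_of_eq (by ring)
    · gcongr
      exact geom_sum_le_inv h0 hA _
  refine (Finset.sum_le_sum fun t _ => h1 t).trans ?_
  rw [← Finset.mul_sum]
  have h2 : 0 ≤ 1 / (1 - ρ) := by
    have : 0 < 1 - ρ := by linarith
    positivity
  refine mul_le_mul_of_nonneg_left ?_ h2
  rw [Finset.sum_range_diag_flip n fun k j => ρ ^ k * inner ℝ (inputs x₀ w j) (v k) ^ 2]
  refine Finset.sum_le_sum fun k _ => ?_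
  rw [← Finset.mul_sum]
  refine mul_le_mul_of_nonneg_left ?_ (pow_nonneg h0 k)
  calc ∑ j ∈ Finset.range (n - k), inner ℝ (inputs x₀ w j) (v k) ^ 2
      ≤ ∑ j ∈ Finset.range (n + 1), inner ℝ (inputs x₀ w j) (v k) ^ 2 :=
        Finset.sum_le_sum_of_subset_of_nonneg (Finset.range_subset_range.2 (by omega))
          fun j _ _ => sq_nonneg _
    _ = _ := by
        rw [Finset.sum_range_succ', add_comm]
        rfl

lemma sum_norm_trajectory_le (n : ℕ) :
    (1 - ‖matCLM A‖) * ∑ t ∈ Finset.range n, ‖trajectory A x₀ w t‖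
      ≤ ‖x₀‖ + ∑ t ∈ Finset.range n, ‖w t‖ := by
  suffices h : (1 - ‖matCLM A‖) * ∑ t ∈ Finset.range n, ‖trajectory A x₀ w t‖
      + ‖trajectory A x₀ w n‖ ≤ ‖x₀‖ + ∑ t ∈ Finset.range n, ‖w t‖ by
    linarith [norm_nonneg (trajectory A x₀ w n)]
  induction n with
  | zero => simp [trajectory]
  | succ n ih =>
    rw [Finset.sum_range_succ, Finset.sum_range_succ]
    have h1 : ‖trajectory A x₀ w (n + 1)‖
        ≤ ‖matCLM A‖ * ‖trajectory A x₀ w n‖ + ‖w n‖ :=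
      (norm_add_le _ _).trans (add_le_add_left ((matCLM A).le_opNorm _) _)
    linarith

lemma norm_le_l1Norm (v : Vec d) : ‖v‖ ≤ l1Norm v := by
  have h0 : 0 ≤ l1Norm v := Finset.sum_nonneg fun i _ => abs_nonneg _
  rw [EuclideanSpace.norm_eq, Real.sqrt_le_left h0]
  simp only [Real.norm_eq_abs, l1Norm]
  exact Finset.sum_sq_le_sq_sum_of_nonneg fun i _ => abs_nonneg _

lemma l1Norm_le (v : Vec d) : l1Norm v ≤ d * ‖v‖ := by
  refine (Finset.sum_le_card_nsmul _ _ ‖v‖ fun i _ => ?_).trans (by simp)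
  exact PiLp.norm_apply_le v i

lemma sum_l1Norm_trajectory_le (hA : ‖matCLM A‖ < 1) (n : ℕ) {b : ℝ}
    (h : ∀ j, |x₀ j| + ∑ t ∈ Finset.range n, |w t j| ≤ b) :
    ∑ t ∈ Finset.range n, l1Norm (trajectory A x₀ w t) ≤ d ^ 2 * b / (1 - ‖matCLM A‖) := by
  have hr : 0 < 1 - ‖matCLM A‖ := by linarith
  have h1 : ‖x₀‖ + ∑ t ∈ Finset.range n, ‖w t‖ ≤ d * b := by
    refine (add_le_add (norm_le_l1Norm _) (Finset.sum_le_sum fun t _ => norm_le_l1Norm _)).trans ?_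
    simp only [l1Norm]
    rw [Finset.sum_comm, ← Finset.sum_add_distrib]
    exact (Finset.sum_le_card_nsmul _ _ b fun j _ => h j).trans (by simp)
  have h2 : ∑ t ∈ Finset.range n, l1Norm (trajectory A x₀ w t)
      ≤ d * ∑ t ∈ Finset.range n, ‖trajectory A x₀ w t‖ := by
    rw [Finset.mul_sum]
    exact Finset.sum_le_sum fun t _ => l1Norm_le _
  rw [le_div_iff₀ hr]
  calc (∑ t ∈ Finset.range n, l1Norm (trajectory A x₀ w t)) * (1 - ‖matCLM A‖)
      ≤ (d * ∑ t ∈ Finset.range n, ‖trajectory A x₀ w t‖) * (1 - ‖matCLM A‖) := by gcongr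
    _ = d * ((1 - ‖matCLM A‖) * ∑ t ∈ Finset.range n, ‖trajectory A x₀ w t‖) := by ring
    _ ≤ d * (d * b) := by
        refine mul_le_mul_of_nonneg_left ?_ (Nat.cast_nonneg d)
        exact (sum_norm_trajectory_le A x₀ w n).trans h1
    _ = d ^ 2 * b := by ring

end Unrolling

/-! ### From slopes in finitely many directions to the minimizer -/

section Minimizer

variable {d : ℕ}

lemma signSlope_le_abs_sub (v : Vec d) (i : Fin d) (y : ℝ) : signSlope v i y ≤ |v i - y| - |v i| := by
  unfold signSlope
  split_ifs with h
  · simp [h]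
  · rcases lt_trichotomy (v i) 0 with hv | hv | hv
    · rw [Real.sign_of_neg hv, abs_of_neg hv]
      linarith [neg_abs_le (v i - y)]
    · rw [hv]; simp
    · rw [Real.sign_of_pos hv, abs_of_pos hv]
      linarith [le_abs_self (v i - y)]

lemma abs_real_sign_le (a : ℝ) : |Real.sign a| ≤ 1 := by
  rcases Real.sign_apply_eq a with h | h | h <;> simp [h]

lemma signSlope_le_add (v : Vec d) (i : Fin d) (y z : ℝ) :
    signSlope v i y ≤ signSlope v i z + |y - z| := by
  unfold signSlope
  split_ifs with h
  · linarith [abs_sub_abs_le_abs_sub y z]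
  · have h1 : |Real.sign (v i) * (y - z)| ≤ |y - z| := by
      rw [abs_mul]
      exact mul_le_of_le_one_left (abs_nonneg _) (abs_real_sign_le _)
    have := (abs_le.1 h1).1
    linarith

lemma signSlope_mul (v : Vec d) (i : Fin d) {c : ℝ} (hc : 0 ≤ c) (y : ℝ) :
    signSlope v i (c * y) = c * signSlope v i y := by
  unfold signSlope
  split_ifs
  · rw [abs_mul, abs_of_nonneg hc]
  · ring

/-- By convexity of the loss, positive slopes in all row directions make `A` the unique
minimizer. -/
lemma l1Solutions_eq_singleton (A : Matrix (Fin d) (Fin d) ℝ) (x₀ : Vec d) (w : ℕ → Vec d) (T : ℕ)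
    (h : ∀ i, ∀ m : Vec d, m ≠ 0 →
      0 < ∑ t ∈ Finset.range T, signSlope (w t) i (inner ℝ (trajectory A x₀ w t) m)) :
    l1Solutions (trajectory A x₀ w) T = {A} := by
  set x := trajectory A x₀ w with hx
  have key : ∀ B, B ≠ A → l1Loss x T A < l1Loss x T B := by
    intro B hB
    let m : Fin d → Vec d := fun i => WithLp.toLp 2 (fun j => B i j - A i j)
    have hcoord : ∀ t i, (x (t + 1) - matCLM B (x t)) i = w t i - inner ℝ (x t) (m i) := by
      intro t i
      have h1 : ∀ M : Matrix (Fin d) (Fin d) ℝ, matCLM M (x t) i = ∑ j, M i j * x t j := fun M => by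
        simp [matCLM, Matrix.ofLp_toEuclideanCLM, Matrix.mulVec, dotProduct]
      have h2 : inner ℝ (x t) (m i) = ∑ j, (B i j - A i j) * x t j := by
        simp [m, PiLp.inner_apply]
      have h3 : x (t + 1) = matCLM A (x t) + w t := rfl
      rw [h3, PiLp.sub_apply, PiLp.add_apply, h1, h1, h2]
      simp only [sub_mul, Finset.sum_sub_distrib]
      ring
    have hcoordA : ∀ t i, (x (t + 1) - matCLM A (x t)) i = w t i := by
      intro t i
      have h3 : x (t + 1) = matCLM A (x t) + w t := rfl
      rw [h3]; simp
    have hnn : ∀ i, 0 ≤ ∑ t ∈ Finset.range T, signSlope (w t) i (inner ℝ (x t) (m i)) := by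
      intro i
      by_cases hm : m i = 0
      · simp [hm, signSlope]
      · exact (h i _ hm).le
    obtain ⟨i₀, hi₀⟩ : ∃ i, m i ≠ 0 := by
      by_contra! hall
      refine hB (Matrix.ext fun i j => ?_)
      have := congrArg (fun v : Vec d => v j) (hall i)
      simpa [m, sub_eq_zero] using this
    have hpos : 0 < ∑ i, ∑ t ∈ Finset.range T, signSlope (w t) i (inner ℝ (x t) (m i)) :=
      Finset.sum_pos' (fun i _ => hnn i) ⟨i₀, Finset.mem_univ _, h i₀ _ hi₀⟩
    have hle : ∑ i, ∑ t ∈ Finset.range T, signSlope (w t) i (inner ℝ (x t) (m i))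
        ≤ l1Loss x T B - l1Loss x T A := by
      simp only [l1Loss, l1Norm, hcoord, hcoordA]
      rw [Finset.sum_comm, ← Finset.sum_sub_distrib]
      refine Finset.sum_le_sum fun t _ => ?_
      rw [← Finset.sum_sub_distrib]
      exact Finset.sum_le_sum fun i _ => signSlope_le_abs_sub _ _ _
    linarith
  ext B
  simp only [l1Solutions, Set.mem_ofPred_eq, Set.mem_singleton_iff]
  constructor
  · intro hB
    by_contra hne
    exact absurd (hB A) (not_le.2 (key B hne))
  · rintro rfl B'
    by_cases hB' : B' = B
    · rw [hB']
    · exact (key B' hB').le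

/-- The vector with the given integer coordinates. -/
def gridVec (k : Fin d → ℤ) : Vec d := WithLp.toLp 2 fun j => (k j : ℝ)

/-- The integer points of the cube `[-N, N]^d` other than the origin. -/
def grid (d N : ℕ) : Finset (Fin d → ℤ) :=
  (Fintype.piFinset fun _ => Finset.Icc (-(N : ℤ)) N).erase 0

lemma card_grid_le (d N : ℕ) : (grid d N).card ≤ (2 * N + 1) ^ d := by
  refine (Finset.card_erase_le).trans ?_
  rw [Fintype.card_piFinset]
  simp
  refine le_of_eq ?_
  congr 1
  omega

lemma gridVec_ne_zero {N : ℕ} {k : Fin d → ℤ} (hk : k ∈ grid d N) : gridVec k ≠ 0 := by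
  intro h
  refine (Finset.mem_erase.1 hk).1 (funext fun j => ?_)
  have := congrArg (fun v : Vec d => v j) h
  simpa [gridVec] using this

lemma abs_inner_le_l1Norm {x z : Vec d} (hz : ∀ j, |z j| ≤ 1) : |inner ℝ x z| ≤ l1Norm x := by
  rw [PiLp.inner_apply]
  refine (Finset.abs_sum_le_sum_abs _ _).trans (Finset.sum_le_sum fun j _ => ?_)
  simp only [RCLike.inner_apply, conj_trivial, abs_mul]
  exact mul_le_of_le_one_left (abs_nonneg _) (hz j)

/-- If the total slope is at least `a` in all grid directions, then it is positive in all
directions: rescale a direction to have sup norm `N` and round it towards the grid. Since some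
coordinate is `± N`, the rounded vector has norm at least `N`. -/
lemma slope_pos_of_grid (x w : ℕ → Vec d) (i : Fin d) (T N : ℕ) {a R : ℝ} (hN : 0 < N) (ha : 0 ≤ a)
    (hR : ∑ t ∈ Finset.range T, l1Norm (x t) ≤ R) (hNa : R < N * a)
    (h : ∀ k ∈ grid d N, a ≤ ∑ t ∈ Finset.range T,
      signSlope (w t) i (inner ℝ (x t) (‖gridVec k‖⁻¹ • gridVec k)))
    {m : Vec d} (hm : m ≠ 0) :
    0 < ∑ t ∈ Finset.range T, signSlope (w t) i (inner ℝ (x t) m) := by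
  have hNr : (0 : ℝ) < N := by exact_mod_cast hN
  obtain ⟨j₁, hj₁⟩ : ∃ j, m j ≠ 0 := by
    by_contra! hall
    exact hm (PiLp.ext fun j => by simpa using hall j)
  obtain ⟨j₀, -, hj₀⟩ := Finset.exists_max_image Finset.univ (fun j => |m j|) ⟨j₁, Finset.mem_univ _⟩
  have hM : 0 < |m j₀| := (abs_pos.2 hj₁).trans_le (hj₀ j₁ (Finset.mem_univ _))
  set c : ℝ := N / |m j₀| with hc
  have hcpos : 0 < c := by positivity
  have hb : ∀ j, |c * m j| ≤ N := by
    intro j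
    rw [abs_mul, abs_of_pos hcpos, hc, div_mul_eq_mul_div, div_le_iff₀ hM]
    exact mul_le_mul_of_nonneg_left (hj₀ j (Finset.mem_univ _)) hNr.le
  let k : Fin d → ℤ := fun j => ⌊c * m j⌋
  have hkb : ∀ j, -(N : ℤ) ≤ k j ∧ k j ≤ N := by
    intro j
    have h1 := abs_le.1 (hb j)
    refine ⟨Int.le_floor.2 (by push_cast; exact h1.1), ?_⟩
    have : (k j : ℝ) ≤ N := (Int.floor_le _).trans h1.2
    exact_mod_cast this
  have hk₀ : |(k j₀ : ℝ)| = N := by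
    have h1 : |c * m j₀| = N := by
      rw [abs_mul, abs_of_pos hcpos, hc, div_mul_cancel₀ _ hM.ne']
    rcases abs_cases (c * m j₀) with ⟨h2, -⟩ | ⟨h2, -⟩
    · have : c * m j₀ = ((N : ℤ) : ℝ) := by push_cast; linarith
      have hk : k j₀ = N := by simp only [k]; rw [this, Int.floor_intCast]
      rw [hk]; simp
    · have : c * m j₀ = ((-(N : ℤ) : ℤ) : ℝ) := by push_cast; linarith
      have hk : k j₀ = -(N : ℤ) := by simp only [k]; rw [this, Int.floor_intCast]
      rw [hk]; simp
  have hkg : k ∈ grid d N := by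
    refine Finset.mem_erase.2 ⟨fun h0 => ?_, Fintype.mem_piFinset.2 fun j => Finset.mem_Icc.2 (hkb j)⟩
    rw [h0] at hk₀
    simp only [Pi.zero_apply, Int.cast_zero, abs_zero] at hk₀
    linarith
  have hnorm : (N : ℝ) ≤ ‖gridVec k‖ := by
    rw [← hk₀]
    exact PiLp.norm_apply_le (gridVec k) j₀
  have hnpos : 0 < ‖gridVec k‖ := hNr.trans_le hnorm
  have hgrid : N * a ≤ ∑ t ∈ Finset.range T, signSlope (w t) i (inner ℝ (x t) (gridVec k)) := by
    have h1 : ∀ t, signSlope (w t) i (inner ℝ (x t) (gridVec k))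
        = ‖gridVec k‖ * signSlope (w t) i (inner ℝ (x t) (‖gridVec k‖⁻¹ • gridVec k)) := by
      intro t
      rw [← signSlope_mul _ _ hnpos.le, inner_smul_right, mul_inv_cancel_left₀ hnpos.ne']
    simp_rw [h1]
    rw [← Finset.mul_sum]
    exact mul_le_mul hnorm (h k hkg) ha hnpos.le
  have hround : ∑ t ∈ Finset.range T, signSlope (w t) i (inner ℝ (x t) (gridVec k))
      ≤ ∑ t ∈ Finset.range T, (signSlope (w t) i (inner ℝ (x t) (c • m)) + l1Norm (x t)) := by
    refine Finset.sum_le_sum fun t _ => (signSlope_le_add _ _ _ _).trans (add_le_add_right ?_ _)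
    rw [← inner_sub_right]
    refine abs_inner_le_l1Norm fun j => ?_
    simp only [PiLp.sub_apply, PiLp.smul_apply, gridVec, smul_eq_mul, k]
    rw [abs_le]
    constructor <;> linarith [Int.floor_le (c * m j), Int.lt_floor_add_one (c * m j)]
  have hscale : ∑ t ∈ Finset.range T, signSlope (w t) i (inner ℝ (x t) (c • m))
      = c * ∑ t ∈ Finset.range T, signSlope (w t) i (inner ℝ (x t) m) := by
    rw [Finset.mul_sum]
    exact Finset.sum_congr rfl fun t _ => by rw [inner_smul_right, signSlope_mul _ _ hcpos.le]
  rw [Finset.sum_add_distrib, hscale] at hround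
  exact pos_of_mul_pos_right (by linarith) hcpos.le

end Minimizer

/-! ### Tail bounds in a fixed direction -/

/-- The rate in the exponent of the failure probability for a fixed direction. -/
def rate (p r s lam : ℝ) (T : ℕ) : ℝ :=
  (1 - p) ^ 2 * r ^ 2 * p * T * (lam ^ 4 / (144 * s ^ 4)) ^ 2 * lam ^ 2 / (16384 * s ^ 2)

namespace AttackModel

variable {d : ℕ} {Ω : Type*} [MeasurableSpace Ω] {μ : Measure Ω} [IsProbabilityMeasure μ]
  {x₀ : Ω → Vec d} {w : ℕ → Ω → Vec d} {p s lam : ℝ}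

lemma measurable_proj (M : AttackModel μ x₀ w p s lam) (A : Matrix (Fin d) (Fin d) ℝ) (u : Vec d)
    (t : ℕ) : Measurable (proj A x₀ w u t) :=
  (measurable_past_proj A u le_rfl).mono (past_le M.meas_init M.meas_noise t) le_rfl

lemma lintegral_exp_sum_le (M : AttackModel μ x₀ w p s lam) {f : ℝ → ℝ} (hf : Measurable f)
    (h0 : f 0 = 0) (u : Vec d) {b : ℝ} (hb0 : 0 ≤ b)
    (hb : ∀ ν : Measure (Vec d), ExpSqBound ν s →
      ∫⁻ v, ENNReal.ofReal (Real.exp (f (inner ℝ v u))) ∂ν ≤ ENNReal.ofReal b) (n : ℕ) :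
    ∫⁻ ω, ENNReal.ofReal (Real.exp (f (inner ℝ (x₀ ω) u)
        + ∑ k ∈ Finset.range n, f (inner ℝ (w k ω) u))) ∂μ
      ≤ ENNReal.ofReal (b * Real.exp (p * (b - 1) * n)) := by
  have hp := M.p_pos
  have hp1 := M.p_lt_one
  have h := M.lintegral_prod_le (φ := fun a => ENNReal.ofReal (Real.exp (f a))) (by fun_prop)
    (by simp [h0]) u hb n
  have e : ∀ ω, ENNReal.ofReal (Real.exp (f (inner ℝ (x₀ ω) u)
        + ∑ k ∈ Finset.range n, f (inner ℝ (w k ω) u)))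
      = ENNReal.ofReal (Real.exp (f (inner ℝ (x₀ ω) u)))
        * ∏ k ∈ Finset.range n, ENNReal.ofReal (Real.exp (f (inner ℝ (w k ω) u))) := by
    intro ω
    rw [Real.exp_add, Real.exp_sum, ENNReal.ofReal_mul (Real.exp_pos _).le,
      ENNReal.ofReal_prod_of_nonneg fun k _ => (Real.exp_pos _).le]
  simp_rw [e]
  refine h.trans ?_
  rw [← ENNReal.ofReal_mul hp.le, ← ENNReal.ofReal_add (by linarith) (by positivity),
    ← ENNReal.ofReal_pow (by nlinarith [mul_nonneg hp.le hb0]), ← ENNReal.ofReal_mul hb0]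
  refine ENNReal.ofReal_le_ofReal (mul_le_mul_of_nonneg_left ?_ hb0)
  rw [mul_comm (p * (b - 1)) (n : ℝ), Real.exp_nat_mul]
  refine pow_le_pow_left₀ (by nlinarith [mul_nonneg hp.le hb0]) ?_ n
  linarith [Real.add_one_le_exp (p * (b - 1))]

/-- The weights `‖A‖ ^ k / ∑ ‖A‖ ^ j` turn the exponent into a convex combination of energies of
the inputs in fixed directions, so Jensen's inequality applies. -/
lemma lintegral_exp_energy_le (M : AttackModel μ x₀ w p s lam) {A : Matrix (Fin d) (Fin d) ℝ}
    (hA : ‖matCLM A‖ < 1) {u : Vec d} (hu : ‖u‖ ≤ 1) (n : ℕ) :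
    ∫⁻ ω, ENNReal.ofReal (Real.exp ((1 - ‖matCLM A‖) ^ 2 / s ^ 2 *
        ∑ t ∈ Finset.range n, proj A x₀ w u t ω ^ 2)) ∂μ
      ≤ ENNReal.ofReal (2 * Real.exp (p * n)) := by
  have hs := M.s_pos
  have hp := M.p_pos
  have hx := M.meas_init
  have hw := M.meas_noise
  rcases Nat.eq_zero_or_pos n with rfl | hn
  · simp only [Finset.range_zero, Finset.sum_empty, mul_zero, Real.exp_zero, ENNReal.ofReal_one,
      lintegral_const, measure_univ, mul_one, Nat.cast_zero]
    exact ENNReal.one_le_ofReal.2 (by norm_num)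
  obtain ⟨v, hv1, hv⟩ := exists_dir A hu
  set ρ := ‖matCLM A‖ with hρ
  have hρ0 : 0 ≤ ρ := norm_nonneg _
  have hr : 0 < 1 - ρ := by linarith
  set S := ∑ k ∈ Finset.range n, ρ ^ k with hS
  have hS1 : 0 < S := by
    refine Finset.sum_pos' (fun k _ => pow_nonneg hρ0 k) ⟨0, Finset.mem_range.2 hn, by simp⟩
  have hS2 : S ≤ 1 / (1 - ρ) := geom_sum_le_inv hρ0 hA n
  let Q : ℕ → Ω → ℝ := fun k ω =>
    inner ℝ (x₀ ω) (v k) ^ 2 / s ^ 2 + ∑ j ∈ Finset.range n, inner ℝ (w j ω) (v k) ^ 2 / s ^ 2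
  have hQm : ∀ k, Measurable (Q k) := fun k => by
    simp only [Q]
    fun_prop
  have hQ0 : ∀ k ω, 0 ≤ Q k ω := fun k ω => by
    simp only [Q]
    positivity
  have hQ : ∀ k, ∫⁻ ω, ENNReal.ofReal (Real.exp (Q k ω)) ∂μ
      ≤ ENNReal.ofReal (2 * Real.exp (p * n)) := by
    intro k
    refine (M.lintegral_exp_sum_le (f := fun a => a ^ 2 / s ^ 2) (by fun_prop) (by simp) (v k)
      (b := 2) (by norm_num) (fun ν hν => by simpa using hν _ (hv1 k)) n).trans (le_of_eq ?_)
    norm_num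
  have hpt : ∀ ω, Real.exp ((1 - ρ) ^ 2 / s ^ 2 * ∑ t ∈ Finset.range n, proj A x₀ w u t ω ^ 2)
      ≤ ∑ k ∈ Finset.range n, ρ ^ k / S * Real.exp (Q k ω) := by
    intro ω
    have h1 := sum_inner_trajectory_sq_le A (x₀ ω) (fun k => w k ω) hA hv n
    rw [← hρ] at h1
    have h2 : (1 - ρ) ^ 2 / s ^ 2 * ∑ t ∈ Finset.range n, proj A x₀ w u t ω ^ 2
        ≤ ∑ k ∈ Finset.range n, ρ ^ k / S * Q k ω := by
      calc (1 - ρ) ^ 2 / s ^ 2 * ∑ t ∈ Finset.range n, proj A x₀ w u t ω ^ 2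
          ≤ (1 - ρ) ^ 2 / s ^ 2 * (1 / (1 - ρ) * ∑ k ∈ Finset.range n, ρ ^ k *
            (inner ℝ (x₀ ω) (v k) ^ 2 + ∑ j ∈ Finset.range n, inner ℝ (w j ω) (v k) ^ 2)) :=
            mul_le_mul_of_nonneg_left h1 (by positivity)
        _ = (1 - ρ) * ∑ k ∈ Finset.range n, ρ ^ k * Q k ω := by
            rw [← mul_assoc, Finset.mul_sum, Finset.mul_sum]
            refine Finset.sum_congr rfl fun k _ => ?_
            simp only [Q]
            rw [← Finset.sum_div]
            field_simp
        _ ≤ 1 / S * ∑ k ∈ Finset.range n, ρ ^ k * Q k ω := by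
            refine mul_le_mul_of_nonneg_right ?_
              (Finset.sum_nonneg fun k _ => mul_nonneg (pow_nonneg hρ0 k) (hQ0 k ω))
            rwa [le_div_iff₀ hS1, mul_comm, ← le_div_iff₀ hr]
        _ = _ := by
            rw [Finset.mul_sum]
            exact Finset.sum_congr rfl fun k _ => by ring
    refine (Real.exp_le_exp.2 h2).trans ?_
    have := convexOn_exp.map_sum_le (t := Finset.range n) (w := fun k => ρ ^ k / S)
      (p := fun k => Q k ω) (fun k _ => by positivity)
      (by rw [← Finset.sum_div, ← hS, div_self hS1.ne']) (fun _ _ => Set.mem_univ _)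
    simpa [smul_eq_mul] using this
  calc ∫⁻ ω, ENNReal.ofReal (Real.exp ((1 - ρ) ^ 2 / s ^ 2 *
        ∑ t ∈ Finset.range n, proj A x₀ w u t ω ^ 2)) ∂μ
      ≤ ∫⁻ ω, ∑ k ∈ Finset.range n,
          ENNReal.ofReal (ρ ^ k / S) * ENNReal.ofReal (Real.exp (Q k ω)) ∂μ := by
        refine lintegral_mono fun ω => (ENNReal.ofReal_le_ofReal (hpt ω)).trans (le_of_eq ?_)
        rw [ENNReal.ofReal_sum_of_nonneg fun k _ => by positivity]
        exact Finset.sum_congr rfl fun k _ => ENNReal.ofReal_mul (by positivity)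
    _ = ∑ k ∈ Finset.range n,
          ENNReal.ofReal (ρ ^ k / S) * ∫⁻ ω, ENNReal.ofReal (Real.exp (Q k ω)) ∂μ := by
        rw [lintegral_finsetSum _ fun k _ => ((hQm k).exp.ennreal_ofReal).const_mul _]
        exact Finset.sum_congr rfl fun k _ => lintegral_const_mul _ (hQm k).exp.ennreal_ofReal
    _ ≤ ∑ k ∈ Finset.range n,
          ENNReal.ofReal (ρ ^ k / S) * ENNReal.ofReal (2 * Real.exp (p * n)) := by
        gcongr
        exact hQ _
    _ = ENNReal.ofReal (2 * Real.exp (p * n)) := by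
        rw [← Finset.sum_mul, ← ENNReal.ofReal_sum_of_nonneg fun k _ => by positivity,
          ← Finset.sum_div, ← hS, div_self hS1.ne', ENNReal.ofReal_one, one_mul]

lemma measure_energy_ge_le (M : AttackModel μ x₀ w p s lam) {A : Matrix (Fin d) (Fin d) ℝ}
    (hA : ‖matCLM A‖ < 1) {u : Vec d} (hu : ‖u‖ ≤ 1) (n : ℕ) :
    μ {ω | 4 * p * n * s ^ 2 / (1 - ‖matCLM A‖) ^ 2 ≤
        ∑ t ∈ Finset.range n, proj A x₀ w u t ω ^ 2}
      ≤ ENNReal.ofReal (2 * Real.exp (-(3 * p * n))) := by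
  have hs := M.s_pos
  have hr : 0 < 1 - ‖matCLM A‖ := by linarith
  have hm := fun t => M.measurable_proj A u t
  refine (measure_mono fun ω hω => ?_).trans ((measure_ge_le_of_lintegral_exp (by fun_prop)
    (M.lintegral_exp_energy_le hA hu n) (4 * p * n)).trans (le_of_eq ?_))
  · have hω' : 4 * p * n * s ^ 2 / (1 - ‖matCLM A‖) ^ 2 ≤
        ∑ t ∈ Finset.range n, proj A x₀ w u t ω ^ 2 := hω
    rw [div_le_iff₀ (by positivity)] at hω'
    change 4 * p * n ≤ _
    rw [div_mul_eq_mul_div, le_div_iff₀ (by positivity)]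
    linarith
  · rw [mul_assoc, ← Real.exp_add]
    congr 3; ring

/-- The `l₁`-mass of the inputs in one coordinate is of order `p T`, not just `T`: this is why the
grid, and hence the final logarithm, need not depend on `p`. -/
lemma measure_coord_ge_le (M : AttackModel μ x₀ w p s lam) (j : Fin d) (n : ℕ) :
    μ {ω | 8 * p * n * s ≤ |x₀ ω j| + ∑ t ∈ Finset.range n, |w t ω j|}
      ≤ ENNReal.ofReal (6 * Real.exp (-(3 * p * n))) := by
  have hs := M.s_pos
  have hp := M.p_pos
  have hx := M.meas_init
  have hw := M.meas_noise
  have h := M.lintegral_exp_sum_le (f := fun a => |a / s|) (by fun_prop) (by simp)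
    (EuclideanSpace.single j (1 : ℝ)) (b := 2 * Real.exp 1) (by positivity)
    (fun ν hν => hν.exp_abs (by simp)) n
  simp only [inner_single_one] at h
  have he := Real.exp_one_lt_d9
  refine (measure_mono fun ω hω => ?_).trans ((measure_ge_le_of_lintegral_exp (by fun_prop)
    h (8 * p * n)).trans (ENNReal.ofReal_le_ofReal ?_))
  · have hω' : 8 * p * n * s ≤ |x₀ ω j| + ∑ t ∈ Finset.range n, |w t ω j| := hω
    change 8 * p * n ≤ _
    simp only [abs_div, abs_of_pos hs]
    rwa [← Finset.sum_div, ← add_div, le_div_iff₀ hs]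
  · rw [mul_assoc, ← Real.exp_add]
    refine mul_le_mul (by linarith) (Real.exp_le_exp.2 ?_) (Real.exp_pos _).le (by norm_num)
    have : 0 ≤ p * n := by positivity
    nlinarith

/-- In a fixed direction, the total slope is at least half of its typical size `(1 - p) ∑ |y_t|`, up to
an exponentially small probability. -/
lemma measure_slope_lt_le (M : AttackModel μ x₀ w p s lam) {A : Matrix (Fin d) (Fin d) ℝ}
    (hA : ‖matCLM A‖ < 1) {u : Vec d} (hu : ‖u‖ = 1) (i : Fin d) {T : ℕ} (hT : 2 ≤ T) :
    μ {ω | ∑ t ∈ Finset.range T, signSlope (w t ω) i (proj A x₀ w u t ω)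
        < (1 - p) * (lam * p * (lam ^ 4 / (144 * s ^ 4)) * T / 8) / 2}
      ≤ ENNReal.ofReal (4 * Real.exp (-rate p (1 - ‖matCLM A‖) s lam T)) := by
  have hs := M.s_pos
  have hp := M.p_pos
  have hp1 := M.p_lt_one
  have hl := M.lam_pos
  have hx := M.meas_init
  have hw := M.meas_noise
  set r := 1 - ‖matCLM A‖ with hrdef
  have hr : 0 < r := by linarith
  have hr1 : r ≤ 1 := by linarith [norm_nonneg (matCLM A)]
  set q := lam ^ 4 / (144 * s ^ 4) with hq
  have hq0 : 0 < q := by positivity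
  have hq1 : q ≤ 1 := by
    rw [hq, div_le_one (by positivity)]
    have : lam ^ 4 ≤ s ^ 4 := pow_le_pow_left₀ hl.le M.lam_le 4
    nlinarith [pow_pos hs 4]
  have hTr : (2 : ℝ) ≤ T := by exact_mod_cast hT
  set S₁ := lam * p * q * T / 8 with hS₁
  have hS₁0 : 0 < S₁ := by positivity
  set V := 4 * p * T * s ^ 2 / r ^ 2 with hV
  have hV0 : 0 < V := by positivity
  -- The tilt `θ` balances the mean `(1 - p) S₁` against the variance proxy `4 θ V`.
  set θ := (1 - p) * S₁ / (16 * V) with hθ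
  have hθ0 : 0 < θ := by
    have : 0 < 1 - p := by linarith
    positivity
  set E := rate p r s lam T with hE
  have hE' : E = θ * (1 - p) * S₁ / 4 := by
    rw [hE, rate, ← hq, hθ, hS₁, hV]
    field_simp
    ring
  have hls : lam ^ 2 / s ^ 2 ≤ 1 := by
    rw [div_le_one (by positivity)]
    exact pow_le_pow_left₀ hl.le M.lam_le 2
  have hE8 : E ≤ p * q * T / 8 := by
    have h1 : (1 - p) ^ 2 ≤ 1 := pow_le_one₀ (by linarith) (by linarith)
    have h2 : r ^ 2 ≤ 1 := pow_le_one₀ hr.le hr1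
    have h3 : q ^ 2 ≤ q := by nlinarith
    have : E = ((1 - p) ^ 2 * r ^ 2 * (lam ^ 2 / s ^ 2)) * (q ^ 2 * (p * T)) / 16384 := by
      rw [hE, rate, ← hq]; field_simp
    have h4 : (1 - p) ^ 2 * r ^ 2 * (lam ^ 2 / s ^ 2) ≤ 1 :=
      mul_le_one₀ (mul_le_one₀ h1 (by positivity) h2) (by positivity) hls
    have h5 : q ^ 2 * (p * T) ≤ q * (p * T) := by gcongr
    have h6 : ((1 - p) ^ 2 * r ^ 2 * (lam ^ 2 / s ^ 2)) * (q ^ 2 * (p * T)) ≤ q ^ 2 * (p * T) :=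
      mul_le_of_le_one_left (by positivity) h4
    have h7 : 0 ≤ q * (p * T) := by positivity
    linarith
  have hE3 : E ≤ 3 * p * T := by
    have : q * (p * T) ≤ p * T := mul_le_of_le_one_left (by positivity) hq1
    have : 0 ≤ p * T := by positivity
    linarith
  have hmp := fun t => M.measurable_proj A u t
  -- Attacks at the times `0, …, T - 2` feed `y_1, …, y_{T-1}`, which costs one time step.
  obtain ⟨n, rfl⟩ : ∃ n, T = n + 1 := ⟨T - 1, by omega⟩
  have hn : ((n + 1 : ℕ) : ℝ) / 2 ≤ n := by push_cast at hTr ⊢; linarith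
  have hmD : ∀ t, Measurable (truncEnergy A x₀ w lam u t) := fun t =>
    Measurable.indicator (by fun_prop) (measurableSet_attack hw t)
  have hmE : ∀ t, Measurable fun ω => slopeExponent p θ (w t ω) i (proj A x₀ w u t ω) :=
    fun t => (measurable_slopeExponent p θ i).comp ((hw t).prodMk (hmp t))
  have B1 : μ {ω | -(p * q * n / 4) ≤ ∑ t ∈ Finset.range n, -truncEnergy A x₀ w lam u t ω}
      ≤ ENNReal.ofReal (Real.exp (-E)) := by
    have h1 := M.lintegral_exp_truncEnergy_le A hu n
    have hpq : p * q ≤ 1 := mul_le_one₀ hp1.le hq0.le hq1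
    rw [← hq, ← ENNReal.ofReal_pow (by linarith)] at h1
    refine (measure_ge_le_of_lintegral_exp (by fun_prop) h1 _).trans (ENNReal.ofReal_le_ofReal ?_)
    have h2 : (1 - p * q / 2) ^ n ≤ Real.exp (n * -(p * q / 2)) := by
      rw [Real.exp_nat_mul]
      exact pow_le_pow_left₀ (by linarith) (by linarith [Real.add_one_le_exp (-(p * q / 2))]) n
    refine (mul_le_mul_of_nonneg_right h2 (Real.exp_pos _).le).trans ?_
    rw [← Real.exp_add, Real.exp_le_exp]
    have : p * q * ((n + 1 : ℕ) / 2) ≤ p * q * n := by gcongr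
    linarith
  have B2 : μ {ω | V ≤ ∑ t ∈ Finset.range (n + 1), proj A x₀ w u t ω ^ 2}
      ≤ ENNReal.ofReal (2 * Real.exp (-E)) := by
    refine (M.measure_energy_ge_le hA hu.le (n + 1)).trans (ENNReal.ofReal_le_ofReal ?_)
    have : Real.exp (-(3 * p * (n + 1 : ℕ))) ≤ Real.exp (-E) := Real.exp_le_exp.2 (by linarith)
    linarith
  have B3 : μ {ω | E ≤ ∑ t ∈ Finset.range (n + 1),
      slopeExponent p θ (w t ω) i (proj A x₀ w u t ω)} ≤ ENNReal.ofReal (Real.exp (-E)) := by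
    have h1 := M.lintegral_exp_slope_le A u i hθ0.le (n + 1)
    rw [← ENNReal.ofReal_one] at h1
    simpa using measure_ge_le_of_lintegral_exp (by fun_prop) h1 E
  have hsub : {ω | ∑ t ∈ Finset.range (n + 1), signSlope (w t ω) i (proj A x₀ w u t ω)
        < (1 - p) * S₁ / 2}
      ⊆ {ω | -(p * q * n / 4) ≤ ∑ t ∈ Finset.range n, -truncEnergy A x₀ w lam u t ω}
        ∪ {ω | V ≤ ∑ t ∈ Finset.range (n + 1), proj A x₀ w u t ω ^ 2}
        ∪ {ω | E ≤ ∑ t ∈ Finset.range (n + 1),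
            slopeExponent p θ (w t ω) i (proj A x₀ w u t ω)} := by
    intro ω hω
    by_contra hcon
    simp only [Set.mem_union, Set.mem_ofPred_eq, not_or, not_le] at hcon hω
    obtain ⟨⟨h1, h2⟩, h3⟩ := hcon
    rw [Finset.sum_neg_distrib] at h1
    have habs : S₁ ≤ ∑ t ∈ Finset.range (n + 1), |proj A x₀ w u t ω| := by
      have h4 : ∀ t, lam * truncEnergy A x₀ w lam u t ω ≤ |proj A x₀ w u (t + 1) ω| := by
        intro t
        by_cases ht : ω ∈ attack w t
        · simp only [truncEnergy, Set.indicator_of_mem ht]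
          set y := proj A x₀ w u (t + 1) ω
          -- `min 1 z² ≤ z` for `z ≥ 0`
          have h5 : min 1 (y ^ 2 / lam ^ 2) ≤ |y| / lam := by
            have h6 : y ^ 2 / lam ^ 2 = (|y| / lam) ^ 2 := by rw [div_pow, sq_abs]
            rw [h6]
            rcases le_total (|y| / lam) 1 with h7 | h7
            · refine (min_le_right _ _).trans ?_
              have : 0 ≤ |y| / lam := by positivity
              nlinarith
            · exact (min_le_left _ _).trans h7
          rwa [mul_comm, ← le_div_iff₀ hl]
        · simp [truncEnergy, ht]
      have h5 : lam * ∑ t ∈ Finset.range n, truncEnergy A x₀ w lam u t ω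
          ≤ ∑ t ∈ Finset.range n, |proj A x₀ w u (t + 1) ω| := by
        rw [Finset.mul_sum]
        exact Finset.sum_le_sum fun t _ => h4 t
      rw [Finset.sum_range_succ']
      have h6 : S₁ ≤ lam * (p * q * n / 4) := by
        have : lam * p * q * ((n + 1 : ℕ) / 2) ≤ lam * p * q * n := by gcongr
        rw [hS₁]; linarith
      have h7 : lam * (p * q * n / 4) ≤ lam * ∑ t ∈ Finset.range n, truncEnergy A x₀ w lam u t ω :=
        mul_le_mul_of_nonneg_left (by linarith) hl.le
      linarith [abs_nonneg (proj A x₀ w u 0 ω)]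
    have hexp : ∑ t ∈ Finset.range (n + 1), slopeExponent p θ (w t ω) i (proj A x₀ w u t ω)
        = -θ * ∑ t ∈ Finset.range (n + 1), signSlope (w t ω) i (proj A x₀ w u t ω)
          + (θ * (1 - p) * ∑ t ∈ Finset.range (n + 1), |proj A x₀ w u t ω|
            - 4 * θ ^ 2 * ∑ t ∈ Finset.range (n + 1), proj A x₀ w u t ω ^ 2) := by
      simp only [slopeExponent, Finset.mul_sum, Finset.sum_add_distrib, Finset.sum_sub_distrib]
    rw [hexp] at h3
    have hθV : 4 * θ ^ 2 * V = θ * (1 - p) * S₁ / 4 := by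
      rw [hθ]; field_simp; ring
    have h4 : θ * (1 - p) * S₁ ≤ θ * (1 - p) * ∑ t ∈ Finset.range (n + 1), |proj A x₀ w u t ω| :=
      mul_le_mul_of_nonneg_left habs (mul_nonneg hθ0.le (by linarith))
    have h5 : 4 * θ ^ 2 * ∑ t ∈ Finset.range (n + 1), proj A x₀ w u t ω ^ 2 ≤ 4 * θ ^ 2 * V :=
      mul_le_mul_of_nonneg_left h2.le (by positivity)
    have h6 := mul_lt_mul_of_pos_left hω hθ0
    linarith
  refine (measure_mono hsub).trans ((measure_union_le _ _).trans
    ((add_le_add ((measure_union_le _ _).trans (add_le_add B1 B2)) B3).trans (le_of_eq ?_)))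
  rw [← ENNReal.ofReal_add (by positivity) (by positivity),
    ← ENNReal.ofReal_add (by positivity) (by positivity)]
  congr 1; ring

end AttackModel

/-! ### Union bound and choice of the grid -/

section Assembly

variable {d : ℕ} {Ω : Type*} [MeasurableSpace Ω] {μ : Measure Ω} [IsProbabilityMeasure μ]
  {x₀ : Ω → Vec d} {w : ℕ → Ω → Vec d} {p s lam : ℝ}

/-- Union bound over all coordinates and grid directions; the event itself need not be
measurable, so its complement is covered by bad events. -/
lemma AttackModel.le_measure_solutions (M : AttackModel μ x₀ w p s lam)
    {A : Matrix (Fin d) (Fin d) ℝ} (hA : ‖matCLM A‖ < 1) {T N : ℕ} (hT : 2 ≤ T) (hN : 0 < N)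
    (hNa : d ^ 2 * (8 * p * T * s) / (1 - ‖matCLM A‖)
      < N * ((1 - p) * (lam * p * (lam ^ 4 / (144 * s ^ 4)) * T / 8) / 2))
    {δ : ℝ} (hδ0 : 0 ≤ δ)
    (hδ : 10 * d * (2 * N + 1) ^ d * Real.exp (-rate p (1 - ‖matCLM A‖) s lam T) ≤ δ) :
    ENNReal.ofReal (1 - δ) ≤
      μ {ω | l1Solutions (trajectory A (x₀ ω) (fun t => w t ω)) T = {A}} := by
  have hs := M.s_pos
  have hp := M.p_pos
  have hp1 := M.p_lt_one
  have hl := M.lam_pos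
  have hr : 0 < 1 - ‖matCLM A‖ := by linarith
  have hr1 : 1 - ‖matCLM A‖ ≤ 1 := by linarith [norm_nonneg (matCLM A)]
  set a := (1 - p) * (lam * p * (lam ^ 4 / (144 * s ^ 4)) * T / 8) / 2 with ha
  have ha0 : 0 ≤ a := by
    have : 0 < 1 - p := by linarith
    positivity
  set E := rate p (1 - ‖matCLM A‖) s lam T with hE
  let dir : (Fin d → ℤ) → Vec d := fun k => ‖gridVec k‖⁻¹ • gridVec k
  let B : Fin d → (Fin d → ℤ) → Set Ω := fun i k =>
    {ω | ∑ t ∈ Finset.range T, signSlope (w t ω) i (proj A x₀ w (dir k) t ω) < a}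
  let C : Fin d → Set Ω := fun j =>
    {ω | 8 * p * T * s ≤ |x₀ ω j| + ∑ t ∈ Finset.range T, |w t ω j|}
  let Bad : Set Ω := (⋃ i ∈ Finset.univ, ⋃ k ∈ grid d N, B i k) ∪ ⋃ j ∈ Finset.univ, C j
  have hgood : {ω | l1Solutions (trajectory A (x₀ ω) (fun t => w t ω)) T = {A}}ᶜ ⊆ Bad := by
    intro ω hω
    by_contra hcon
    refine hω (l1Solutions_eq_singleton A (x₀ ω) (fun t => w t ω) T fun i m hm => ?_)
    simp only [Bad, B, C, Set.mem_union, Set.mem_iUnion, Set.mem_ofPred_eq, not_or, not_exists,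
      not_lt, not_le] at hcon
    obtain ⟨h1, h2⟩ := hcon
    exact slope_pos_of_grid _ (fun t => w t ω) i T N hN ha0
      (sum_l1Norm_trajectory_le A (x₀ ω) (fun t => w t ω) hA T
        fun j => (h2 j (Finset.mem_univ _)).le) hNa
      (fun k hk => h1 i (Finset.mem_univ _) k hk) hm
  have hB : ∀ i, ∀ k ∈ grid d N, μ (B i k) ≤ ENNReal.ofReal (4 * Real.exp (-E)) := by
    intro i k hk
    refine M.measure_slope_lt_le hA ?_ i hT
    rw [norm_smul, norm_inv, norm_norm, inv_mul_cancel₀ (norm_ne_zero_iff.2 (gridVec_ne_zero hk))]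
  have hE3 : E ≤ 3 * p * T := by
    have h1 : (1 - p) ^ 2 ≤ 1 := pow_le_one₀ (by linarith) (by linarith)
    have h2 : (1 - ‖matCLM A‖) ^ 2 ≤ 1 := pow_le_one₀ hr.le hr1
    have h3 : lam / s ≤ 1 := (div_le_one hs).2 M.lam_le
    have h4 : (lam / s) ^ 10 ≤ 1 := pow_le_one₀ (by positivity) h3
    have h5 : E = ((1 - p) ^ 2 * (1 - ‖matCLM A‖) ^ 2 * (lam / s) ^ 10) * (p * T)
        / (144 ^ 2 * 16384) := by
      rw [hE, rate]; field_simp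
    have h6 : ((1 - p) ^ 2 * (1 - ‖matCLM A‖) ^ 2 * (lam / s) ^ 10) * (p * T) ≤ p * T :=
      mul_le_of_le_one_left (by positivity)
        (mul_le_one₀ (mul_le_one₀ h1 (by positivity) h2) (by positivity) h4)
    have h7 : 0 ≤ p * T := by positivity
    linarith
  have hC : ∀ j, μ (C j) ≤ ENNReal.ofReal (6 * Real.exp (-E)) := fun j =>
    (M.measure_coord_ge_le j T).trans (ENNReal.ofReal_le_ofReal
      (mul_le_mul_of_nonneg_left (Real.exp_le_exp.2 (by linarith)) (by norm_num)))
  have hBad : μ Bad ≤ ENNReal.ofReal δ := by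
    have h1 : μ (⋃ i ∈ Finset.univ, ⋃ k ∈ grid d N, B i k)
        ≤ ENNReal.ofReal (d * ((2 * N + 1) ^ d * (4 * Real.exp (-E)))) := by
      refine (measure_biUnion_finset_le _ _).trans ((Finset.sum_le_card_nsmul _ _
        (ENNReal.ofReal ((2 * N + 1) ^ d * (4 * Real.exp (-E)))) fun i _ => ?_).trans ?_)
      · refine (measure_biUnion_finset_le _ _).trans ((Finset.sum_le_card_nsmul _ _ _
          (hB i)).trans ?_)
        rw [nsmul_eq_mul, ← ENNReal.ofReal_natCast, ← ENNReal.ofReal_mul (by positivity)]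
        refine ENNReal.ofReal_le_ofReal (mul_le_mul_of_nonneg_right ?_ (by positivity))
        exact_mod_cast card_grid_le d N
      · rw [nsmul_eq_mul, ← ENNReal.ofReal_natCast, ← ENNReal.ofReal_mul (by positivity)]
        simp
    have h2 : μ (⋃ j ∈ Finset.univ, C j) ≤ ENNReal.ofReal (d * (6 * Real.exp (-E))) := by
      refine (measure_biUnion_finset_le _ _).trans ((Finset.sum_le_card_nsmul _ _ _
        fun j _ => hC j).trans ?_)
      rw [nsmul_eq_mul, ← ENNReal.ofReal_natCast, ← ENNReal.ofReal_mul (by positivity)]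
      simp
    refine (measure_union_le _ _).trans ((add_le_add h1 h2).trans ?_)
    rw [← ENNReal.ofReal_add (by positivity) (by positivity)]
    refine ENNReal.ofReal_le_ofReal (le_trans ?_ hδ)
    have h3 : (1 : ℝ) ≤ (2 * N + 1) ^ d := one_le_pow₀ (by linarith [(Nat.cast_nonneg N : (0:ℝ) ≤ N)])
    have h4 : 0 ≤ d * Real.exp (-E) := by positivity
    nlinarith
  have htot : (1 : ℝ≥0∞) ≤ μ {ω | l1Solutions (trajectory A (x₀ ω) (fun t => w t ω)) T = {A}}
      + ENNReal.ofReal δ := by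
    rw [← measure_univ (μ := μ), ← Set.union_compl_self
      {ω | l1Solutions (trajectory A (x₀ ω) (fun t => w t ω)) T = {A}}]
    exact (measure_union_le _ _).trans (by gcongr; exact (measure_mono hgood).trans hBad)
  rw [ENNReal.ofReal_sub _ hδ0, ENNReal.ofReal_one]
  exact tsub_le_iff_right.2 htot

/-- The arithmetic of the sample size: with `N ≈ Q ^ 5` grid points per axis, where
`Q = d τ / ((1 - p) r)` with `τ = s / lam`, the union bound costs `exp (O (d L))`. -/
lemma exists_grid_size {d T : ℕ} {p r s lam δ L : ℝ} (hd : 1 ≤ d) (hp : 0 < p) (hp1 : p < 1)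
    (hr : 0 < r) (hr1 : r ≤ 1) (hs : 0 < s) (hl : 0 < lam) (hls : lam ≤ s) (hδ : 0 < δ)
    (hδ1 : δ ≤ 1) (hT : 0 < T) (hL : 1 ≤ L)
    (hL' : Real.log (d * (s / lam) / (δ * (1 - p) * r)) ≤ L + 1)
    (hrate : 27 * d * L ≤ rate p r s lam T) :
    ∃ N : ℕ, 0 < N ∧ d ^ 2 * (8 * p * T * s) / r
        < N * ((1 - p) * (lam * p * (lam ^ 4 / (144 * s ^ 4)) * T / 8) / 2) ∧
      10 * d * (2 * N + 1) ^ d * Real.exp (-rate p r s lam T) ≤ δ := by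
  have hdr : (1 : ℝ) ≤ d := by exact_mod_cast hd
  have hTr : (0 : ℝ) < T := by exact_mod_cast hT
  have hp' : 0 < 1 - p := by linarith
  set Q := d * (s / lam) / ((1 - p) * r) with hQ
  have hτ : 1 ≤ s / lam := (one_le_div hl).2 hls
  have hpr : (1 - p) * r ≤ 1 := mul_le_one₀ (by linarith) hr.le hr1
  have hpr0 : 0 < (1 - p) * r := by positivity
  have hQ1 : 1 ≤ Q := by
    rw [hQ, one_le_div hpr0]
    nlinarith
  have hQ0 : 0 < Q := by linarith
  refine ⟨⌊18432 * Q ^ 5⌋₊ + 1, Nat.succ_pos _, ?_, ?_⟩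
  · have h1 : d ^ 2 * (8 * p * T * s) / r
        = 18432 * (d ^ 2 * (s / lam) ^ 5 / ((1 - p) * r))
          * ((1 - p) * (lam * p * (lam ^ 4 / (144 * s ^ 4)) * T / 8) / 2) := by
      field_simp; norm_num
    rw [h1]
    have h2 : (d : ℝ) ^ 2 * (s / lam) ^ 5 / ((1 - p) * r) ≤ Q ^ 5 := by
      rw [hQ, div_pow _ ((1 - p) * r), mul_pow (d : ℝ)]
      have h3 : (d : ℝ) ^ 2 ≤ d ^ 5 := pow_le_pow_right₀ hdr (by norm_num)
      have h4 : ((1 - p) * r) ^ 5 ≤ (1 - p) * r := pow_le_of_le_one hpr0.le hpr (by norm_num)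
      gcongr
    refine mul_lt_mul_of_pos_right ?_ (by positivity)
    push_cast
    exact (mul_le_mul_of_nonneg_left h2 (by norm_num)).trans_lt (Nat.lt_floor_add_one _)
  · set N := ⌊18432 * Q ^ 5⌋₊ + 1 with hN
    have hQ5 : 1 ≤ Q ^ 5 := one_le_pow₀ hQ1
    have h1 : (N : ℝ) ≤ 18433 * Q ^ 5 := by
      rw [hN]; push_cast
      linarith [Nat.floor_le (show 0 ≤ 18432 * Q ^ 5 by positivity)]
    have he : (36867 : ℝ) ≤ Real.exp 11 := by
      have h2 := Real.exp_one_gt_d9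
      have h3 : Real.exp 11 = Real.exp 1 ^ 11 := by
        rw [← Real.exp_nat_mul]; norm_num
      rw [h3]
      refine le_trans ?_ (pow_le_pow_left₀ (by norm_num) (show (2.7 : ℝ) ≤ Real.exp 1 by linarith) 11)
      norm_num
    have h2 : (2 * N + 1 : ℝ) ≤ Real.exp (11 + 5 * Real.log Q) := by
      have h3 : Real.exp (5 * Real.log Q) = Q ^ 5 := by
        have := Real.exp_nat_mul (Real.log Q) 5
        rw [Real.exp_log hQ0] at this
        exact_mod_cast this
      rw [Real.exp_add, h3]
      nlinarith
    have h3 : (2 * N + 1 : ℝ) ^ d ≤ Real.exp (d * (11 + 5 * Real.log Q)) := by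
      rw [Real.exp_nat_mul]
      exact pow_le_pow_left₀ (by positivity) h2 d
    have h4 : (10 * d : ℝ) ≤ Real.exp (3 + d) := by
      have h5 := Real.exp_one_gt_d9
      have h6 : Real.exp 3 = Real.exp 1 ^ 3 := by
        rw [← Real.exp_nat_mul]; norm_num
      have h7 : (10 : ℝ) ≤ Real.exp 3 := by
        rw [h6]
        refine le_trans ?_ (pow_le_pow_left₀ (by norm_num)
          (show (2.7 : ℝ) ≤ Real.exp 1 by linarith) 3)
        norm_num
      rw [Real.exp_add]
      exact mul_le_mul h7 (by linarith [Real.add_one_le_exp (d : ℝ)]) (by positivity)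
        (Real.exp_pos _).le
    have hlog : Real.log (d * (s / lam) / (δ * (1 - p) * r)) = Real.log Q - Real.log δ := by
      rw [← Real.log_div hQ0.ne' hδ.ne', hQ]
      congr 1
      field_simp
    have hlQ : 0 ≤ Real.log Q := Real.log_nonneg hQ1
    have hlδ : Real.log δ ≤ 0 := Real.log_nonpos hδ.le hδ1
    rw [hlog] at hL'
    calc 10 * d * (2 * N + 1) ^ d * Real.exp (-rate p r s lam T)
        ≤ Real.exp (3 + d) * Real.exp (d * (11 + 5 * Real.log Q)) * Real.exp (-(27 * d * L)) := by
          gcongr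
      _ = Real.exp (3 + d + d * (11 + 5 * Real.log Q) - 27 * d * L) := by
          rw [← Real.exp_add, ← Real.exp_add]; congr 1
      _ ≤ Real.exp (Real.log δ) := by
          refine Real.exp_le_exp.2 ?_
          have h5 : d * Real.log Q ≤ d * (L + 1) := by gcongr; linarith
          have h6 : (d : ℝ) ≤ d * L := le_mul_of_one_le_right (by linarith) hL
          have h7 : L ≤ d * L := le_mul_of_one_le_left (by linarith) hdr
          nlinarith
      _ = δ := Real.exp_log hδ

end Assembly

end LinSysId

end

open LinSysId in
theorem theorem2 :
    ∃ C : ℝ, 0 < C ∧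
      ∀ (d : ℕ) (A : Matrix (Fin d) (Fin d) ℝ) (p σ lam δ : ℝ)
        (Ω : Type*) [MeasurableSpace Ω] (μ : Measure Ω) [IsProbabilityMeasure μ]
        (x₀ : Ω → Vec d) (w : ℕ → Ω → Vec d),
        Measurable x₀ → (∀ t, Measurable (w t)) →
        ‖matCLM A‖ < 1 →
        0 < p → p < 1 → 0 < σ → 0 < lam → 0 < δ → δ ≤ 1 →
        MaxSubGaussianNorm μ x₀ w σ →
        ProbabilisticAttack μ x₀ w p →
        NonDegenerate μ x₀ w lam →
        SignRestricted μ x₀ w →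
        ∀ T : ℕ,
          C * ((d * max 1 ((σ / lam) ^ 10)) / (p * (1 - p) ^ 2 * (1 - ‖matCLM A‖) ^ 2)
            * max 1 (Real.log (d * (σ / lam) / (δ * (1 - p) * (1 - ‖matCLM A‖))))) ≤ (T : ℝ) →
          ENNReal.ofReal (1 - δ) ≤
            μ {ω | l1Solutions (trajectory A (x₀ ω) (fun t => w t ω)) T = {A}} := by
  refine ⟨10 ^ 13, by norm_num, ?_⟩
  intro d A p σ lam δ Ω _ μ _ x₀ w hx hw hA hp hp1 hσ hl hδ hδ1 hsub hatt hnd hsign T hT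
  rcases Nat.eq_zero_or_pos d with rfl | hd
  · have : ∀ ω, l1Solutions (trajectory A (x₀ ω) (fun t => w t ω)) T = {A} := fun ω =>
      l1Solutions_eq_singleton A _ _ T fun i => i.elim0
    simp only [this, Set.ofPred_true, measure_univ]
    exact ENNReal.ofReal_le_one.2 (by linarith)
  have hs : 0 < 2 * σ := by linarith
  have hnoise : ∀ t, ∀ᵐ ω ∂(μ[|attack w t]),
      ExpSqBound (lawGivenPastAttack μ x₀ w t (w t) ω) (2 * σ) := fun t => by
    filter_upwards [hsub.2 t] with ω hω using expSqBound_of_vecPsi2Norm_le hσ hω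
  have hls : lam ≤ 2 * σ := by
    have hne : μ (attack w 0) ≠ 0 := by
      rw [measure_attack hx hw hp1 hatt]; simpa using hp
    have : IsProbabilityMeasure (μ[|attack w 0]) := cond_isProbabilityMeasure hne
    obtain ⟨ω, h1, h2⟩ := ((hnoise 0).and (hnd 0)).exists
    exact le_of_posSemidef hd hs h1 h2
  have M : AttackModel μ x₀ w p (2 * σ) lam :=
    ⟨hx, hw, hp, hp1, hs, hl, hls, expSqBound_of_vecPsi2Norm_le hσ hsub.1, hnoise, hatt, hnd, hsign⟩
  have hr : 0 < 1 - ‖matCLM A‖ := by linarith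
  have hr1 : 1 - ‖matCLM A‖ ≤ 1 := by linarith [norm_nonneg (matCLM A)]
  set r := 1 - ‖matCLM A‖ with hrdef
  set L := max 1 (Real.log (d * (σ / lam) / (δ * (1 - p) * r))) with hL
  have hL1 : 1 ≤ L := le_max_left _ _
  have hp' : 0 < 1 - p := by linarith
  have hdr : (1 : ℝ) ≤ d := by exact_mod_cast hd
  set m := max 1 ((σ / lam) ^ 10) with hm
  have hm1 : 1 ≤ m := le_max_left _ _
  have hden : 0 < p * (1 - p) ^ 2 * r ^ 2 := by positivity
  have hT' : 10 ^ 13 * (d * m * L) ≤ T * (p * (1 - p) ^ 2 * r ^ 2) := by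
    rw [← div_le_iff₀ hden]
    refine le_trans (le_of_eq ?_) hT
    ring
  have hdm : 1 ≤ d * m * L := one_le_mul_of_one_le_of_one_le
    (one_le_mul_of_one_le_of_one_le hdr hm1) hL1
  have hT2 : 2 ≤ T := by
    have h1 : p * (1 - p) ^ 2 * r ^ 2 ≤ 1 :=
      mul_le_one₀ (mul_le_one₀ hp1.le (by positivity) (pow_le_one₀ hp'.le (by linarith)))
        (by positivity) (pow_le_one₀ hr.le hr1)
    have h2 : (T : ℝ) * (p * (1 - p) ^ 2 * r ^ 2) ≤ T :=
      mul_le_of_le_one_right (Nat.cast_nonneg T) h1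
    have h3 : (2 : ℝ) ≤ T := by linarith
    exact_mod_cast h3
  have hlog : Real.log (d * (2 * σ / lam) / (δ * (1 - p) * r)) ≤ L + 1 := by
    have h1 : d * (2 * σ / lam) / (δ * (1 - p) * r)
        = 2 * (d * (σ / lam) / (δ * (1 - p) * r)) := by ring
    have h2 : (0 : ℝ) < d * (σ / lam) / (δ * (1 - p) * r) := by positivity
    rw [h1, Real.log_mul (by norm_num) h2.ne']
    have h3 : Real.log (d * (σ / lam) / (δ * (1 - p) * r)) ≤ L := le_max_right _ _
    linarith [Real.log_two_lt_d9]
  have hrate : 27 * d * L ≤ rate p r (2 * σ) lam T := by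
    have h1 : rate p r (2 * σ) lam T = T * (p * (1 - p) ^ 2 * r ^ 2)
        / (144 ^ 2 * 16384 * 1024 * (σ / lam) ^ 10) := by
      rw [rate]; field_simp; norm_num
    rw [h1, le_div_iff₀ (by positivity)]
    have h2 : (σ / lam) ^ 10 ≤ m := le_max_right _ _
    have h3 : d * L * (σ / lam) ^ 10 ≤ d * L * m := by gcongr
    have h4 : 0 ≤ d * L * (σ / lam) ^ 10 := by positivity
    nlinarith
  obtain ⟨N, hN, hNa, hNδ⟩ := exists_grid_size hd hp hp1 hr hr1 hs hl hls hδ hδ1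
    (by omega : 0 < T) hL1 hlog hrate
  exact M.le_measure_solutions hA hT2 hN hNa hδ.le hNδ
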